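/- All graphs are finite and simple. For a graph $G$, $\alpha(G)$ and $\omega(G)$ denote the maximum size of a stable set and of a clique of $G$, and $\chi(G)$ and $\theta(G)$ the minimum number of stable sets, respectively of cliques, needed to cover the vertices of $G$. A graph $G$ is $\chi$-bounded (resp. $\theta$-bounded) by a function $f:\mathbb N\to\mathbb R$ if $\chi(H)\le f(\omega(H))$ (resp. $\theta(H)\le f(\alpha(H))$) for every induced subgraph $H$ of $G$. A function $f$ is a $\theta$-bounding function of a class of graphs if every graph of the class is $\theta$-bounded by $f$, and the optimal $\theta$-bounding function of the class is the pointwise smallest such function. The optimal complementary bounding function $f^*$ of $f$ is the optimal $\theta$-bounding function of the class of graphs $\chi$-bounded by $f$. Let $\mathcal C$ be the class of graphs $G$ such that $\alpha(H)\ge |V(H)|/3$ for every induced subgraph $H$ of $G$. Let $R_{3,5}$ be the graph on $\mathbb Z/13\mathbb Z$ in which $x$ and $y$ are adjacent if and only if $x-y\in\{\pm1,\pm5\}$, and let $G_{5,8}$ be the $15$-vertex graph obtained from $R_{3,5}$ by subdividing the edge $\{0,1\}$ twice, that is, by replacing it with a path of length $3$ through two new vertices. **Theorem.** 1. Every $3$-colourable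 graph belongs to $\mathcal C$. 2. Every graph $G$ in $\mathcal C$ satisfies $\theta(G)\le\left\lfloor\frac85\alpha(G)\right\rfloor$. 3. This is best possible for every value of $\alpha$: for every integer $x\ge 0$, write $x=5k+2b+c$ with $k=\lfloor x/5\rfloor$, $b\in\{0,1,2\}$, $c\in\{0,1\}$ and $2b+c\le 4$, and let $G$ be the disjoint union of $k$ copies of $G_{5,8}$, $b$ pentagons and $c$ isolated vertices. Then $G$ is $3$-colourable, $G$ belongs to $\mathcal C$, $\alpha(G)=x$ and $\theta(G)=\left\lfloor\frac85x\right\rfloor$. 4. The optimal $\theta$-bounding function of $\mathcal C$ is $x\mapsto\left\lfloor\frac85x\right\rfloor$, and so is the optimal complementary bounding function $3^*$ of the constant function $3$. -/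

import Mathlib

universe u v

noncomputable section

namespace ComplementaryBounding

/-- `θ(G)`: the minimum number of cliques needed to cover the vertices of the (finite) graph `G`.
The set below is nonempty when `V` is finite, since single vertices are cliques. -/
def theta {V : Type u} (G : SimpleGraph V) : ℕ :=
  sInf {n : ℕ | ∃ c : Fin n → Set V, (∀ i, G.IsClique (c i)) ∧ ∀ w : V, ∃ i, w ∈ c i}

/-- `G` is `χ`-bounded by `f`: every induced subgraph `H` of `G` satisfies `χ(H) ≤ f(ω(H))`.
It is used for finite graphs only, whose chromatic number is finite, so that `toNat` is
harmless. -/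
def ChiBoundedBy {V : Type u} (G : SimpleGraph V) (f : ℕ → ℝ) : Prop :=
  ∀ S : Set V,
    ((G.induce S).chromaticNumber.toNat : ℝ) ≤ f (G.induce S).cliqueNum

/-- `G` is `θ`-bounded by `f`: every induced subgraph `H` of `G` satisfies `θ(H) ≤ f(α(H))`. -/
def ThetaBoundedBy {V : Type u} (G : SimpleGraph V) (f : ℕ → ℝ) : Prop :=
  ∀ S : Set V, (theta (G.induce S) : ℝ) ≤ f (G.induce S).indepNum

/-- Classes of finite simple graphs. -/
abbrev GraphClass : Type (u + 1) := ∀ V : Type u, [Finite V] → SimpleGraph V → Prop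

/-- `f` is a `θ`-bounding function of the class `C`. -/
def IsThetaBoundingFunction (C : GraphClass.{u}) (f : ℕ → ℝ) : Prop :=
  ∀ (V : Type u) [Finite V] (G : SimpleGraph V), C V G → ThetaBoundedBy G f

/-- `f` is the optimal, that is the (pointwise) smallest, `θ`-bounding function of `C`. -/
def IsOptimalThetaBoundingFunction (C : GraphClass.{u}) (f : ℕ → ℝ) : Prop :=
  IsLeast {g : ℕ → ℝ | IsThetaBoundingFunction C g} f

/-- The class of graphs `χ`-bounded by `f`. -/
def chiBoundedClass (f : ℕ → ℝ) : GraphClass.{u} := fun _ _ G => ChiBoundedBy G f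

/-- `g = f^*`: `g` is the optimal complementary bounding function of `f`, that is, the optimal
`θ`-bounding function of the class of graphs `χ`-bounded by `f`. -/
def IsOptimalComplementaryBoundingFunction (f g : ℕ → ℝ) : Prop :=
  IsOptimalThetaBoundingFunction (chiBoundedClass.{u} f) g

/-- The class `𝒞`: every induced subgraph `H` of `G` satisfies `α(H) ≥ |V(H)| / 3`. -/
def classC : GraphClass.{u} := fun V _ G =>
  ∀ S : Set V, (Nat.card S : ℝ) / 3 ≤ (G.induce S).indepNum

/-- The graph obtained from `G` by subdividing the edge `ab` twice: the edge `ab` is replaced by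
the path `a – inr 0 – inr 1 – b`. -/
def subdivideTwice {V : Type u} (G : SimpleGraph V) (a b : V) : SimpleGraph (V ⊕ Fin 2) :=
  SimpleGraph.fromRel fun p q =>
    match p, q with
    | .inl x, .inl y => G.Adj x y ∧ s(x, y) ≠ s(a, b)
    | .inl x, .inr i => (x = a ∧ i = 0) ∨ (x = b ∧ i = 1)
    | .inr i, .inr j => i = 0 ∧ j = 1
    | .inr _, .inl _ => False

/-- `R_{3,5}`, the unique graph on 13 vertices with `ω = 2` and `α = 4`: the circulant graph on
`ℤ/13ℤ` in which `x` and `y` are adjacent when `x - y ∈ {±1, ±5}`. -/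
def R35 : SimpleGraph (ZMod 13) := SimpleGraph.circulantGraph {1, 5}

/-- `G_{5,8}`: the 15-vertex graph obtained from `R_{3,5}` by subdividing one edge twice.
(Multiplication by `5` and translations act transitively on the edges of `R_{3,5}`, so the choice
of the edge is immaterial.) -/
def G58 : SimpleGraph (ZMod 13 ⊕ Fin 2) := subdivideTwice R35 0 1

/-- The disjoint union of `k` copies of `G`. -/
def copies {V : Type u} (k : ℕ) (G : SimpleGraph V) : SimpleGraph (Fin k × V) where
  Adj p q := p.1 = q.1 ∧ G.Adj p.2 q.2
  symm := ⟨fun _ _ h => ⟨h.1.symm, h.2.symm⟩⟩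
  loopless := ⟨fun _ h => G.loopless.irrefl _ h.2⟩

/-- The disjoint union of `a` copies of `G_{5,8}`, `b` pentagons and `c` isolated vertices. -/
def unionGraph (a b c : ℕ) :
    SimpleGraph (((Fin a × (ZMod 13 ⊕ Fin 2)) ⊕ (Fin b × Fin 5)) ⊕ (Fin c × Unit)) :=
  ((copies a G58).sum (copies b (SimpleGraph.cycleGraph 5))).sum
    (copies c (⊥ : SimpleGraph Unit))

end ComplementaryBounding

end

noncomputable section

namespace ComplementaryBounding


/-! Upper bound. The inequality `5 θ ≤ 8 α` is proved for all induced subgraphs by induction on the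
number of vertices. Both parameters are additive over anticomplete unions, and deleting a vertex
that does not lower `θ` does not raise `α`, so only connected vertex-critical graphs matter. For
these, Gallai's theorem (`two_mul_theta_induce_le`) and membership in `𝒞` give `2θ ≤ n + 1 ≤ 3α +
1`. This suffices for `α = 2`, `α = 4` and `α ≥ 5`, and `α = 1` is the case of a clique. Only `α =
3`, `n = 9`, `θ = 5` escapes; `theta_induce_le_four_of_ncard_eq_nine` excludes it by removing a
triangle, which exists because `R(3,4) ≤ 9`, and analysing the six remaining vertices.

Gallai's theorem is proved by exchange: in a minimum clique cover with fewest singletons, two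
singletons could be moved along alternating paths until they become adjacent, which contradicts
optimality. So there is at most one singleton, and `n ≥ 2θ - 1`.

Sharpness. A triangle-free graph has `θ ≥ n/2`, so `G_{5,8}`, with 15 vertices and `α = 5`, needs 8
cliques. `R_{3,5}` itself is not 3-colourable, since `13 > 3 · 4`; subdividing an edge restores
3-colourability and raises `α` by only one. Disjoint unions with pentagons and points then attain
every value. -/

/-- The fibres of `f` on `S` are cliques of `G`. -/
def CliqueColoringOn {V : Type*} {ι : Type*} (G : SimpleGraph V) (f : V → ι) (S : Set V) : Prop :=
  ∀ ⦃a⦄, a ∈ S → ∀ ⦃b⦄, b ∈ S → f a = f b → a ≠ b → G.Adj a b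

/-! ### Clique covers and stable sets of induced subgraphs. -/

section Basic

variable {V : Type*} {G : SimpleGraph V} {S T : Set V}

lemma CliqueColoringOn.mono {ι : Type*} {f : V → ι} (h : CliqueColoringOn G f T) (hST : S ⊆ T) :
    CliqueColoringOn G f S :=
  fun _ ha _ hb => h (hST ha) (hST hb)

lemma theta_induce_le_of_coloring [Finite V] {ι : Type*} {f : V → ι}
    (hf : CliqueColoringOn G f S) : theta (G.induce S) ≤ (f '' S).ncard := by
  classical
  have hfin : (f '' S).Finite := Set.toFinite _
  have e : (f '' S) ≃ Fin (f '' S).ncard := by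
    have := hfin.to_subtype
    exact Finite.equivFinOfCardEq (Nat.card_coe_set_eq _)
  refine Nat.sInf_le ⟨fun i => {x : S | f x = e.symm i}, ?_, ?_⟩
  · intro i a ha b hb hab
    refine hf a.2 b.2 (ha.trans hb.symm) ?_
    exact fun h => hab (Subtype.ext h)
  · intro w
    exact ⟨e ⟨f w, w, w.2, rfl⟩, by simp⟩

lemma exists_coloring_theta [Finite V] (G : SimpleGraph V) :
    ∃ f : V → Fin (theta G), CliqueColoringOn G f Set.univ := by
  have hne : {n : ℕ | ∃ c : Fin n → Set V, (∀ i, G.IsClique (c i)) ∧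
      ∀ w : V, ∃ i, w ∈ c i}.Nonempty :=
    ⟨Nat.card V, fun i => {(Finite.equivFin V).symm i}, fun i => by simp,
      fun w => ⟨Finite.equivFin V w, by simp⟩⟩
  obtain ⟨c, hc, hw⟩ := Nat.sInf_mem hne
  choose f hf using hw
  exact ⟨f, fun a _ b _ h hab => hc (f a) (hf a) (h ▸ hf b) hab⟩

/-- Colours are natural numbers below `theta`, so that the value `theta` itself stays free as a
fresh colour. -/
lemma exists_coloringOn_theta [Finite V] (G : SimpleGraph V) (S : Set V) :
    ∃ f : V → ℕ, CliqueColoringOn G f S ∧ (∀ x, x ∈ S → f x < theta (G.induce S)) ∧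
      (f '' S).ncard = theta (G.induce S) := by
  classical
  obtain ⟨f, hf⟩ := exists_coloring_theta (G.induce S)
  let g : V → ℕ := fun x => if h : x ∈ S then (f ⟨x, h⟩ : ℕ) else 0
  have hg : CliqueColoringOn G g S := by
    intro a ha b hb hab hne
    simp only [g, ha, hb, dif_pos] at hab
    exact hf (a := ⟨a, ha⟩) trivial (b := ⟨b, hb⟩) trivial (Fin.ext hab) (by simpa using hne)
  have hlt : ∀ x, x ∈ S → g x < theta (G.induce S) := by
    intro x hx
    simp only [g, hx, dif_pos]
    exact (f ⟨x, hx⟩).2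
  refine ⟨g, hg, hlt, le_antisymm ?_ (theta_induce_le_of_coloring hg)⟩
  calc (g '' S).ncard ≤ (Set.Iio (theta (G.induce S))).ncard := by
        refine Set.ncard_le_ncard ?_ (Set.finite_Iio _)
        rintro _ ⟨x, hx, rfl⟩
        exact hlt x hx
    _ = theta (G.induce S) := by
        rw [← Nat.card_coe_set_eq]; simp

lemma theta_le_of_embedding {W : Type*} [Finite V] [Finite W] {H : SimpleGraph W} (e : H ↪g G) :
    theta H ≤ theta G := by
  obtain ⟨f, hf⟩ := exists_coloring_theta G
  refine Nat.sInf_le ⟨fun i => {x | f (e x) = i}, ?_, fun w => ⟨f (e w), rfl⟩⟩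
  intro i a ha b hb hab
  exact e.map_adj_iff.1 (hf trivial trivial (ha.trans hb.symm) (fun h => hab (e.injective h)))

lemma theta_congr {W : Type*} [Finite V] [Finite W] {H : SimpleGraph W} (e : H ≃g G) :
    theta H = theta G :=
  le_antisymm (theta_le_of_embedding e.toEmbedding) (theta_le_of_embedding e.symm.toEmbedding)

lemma theta_induce_univ [Finite V] : theta (G.induce Set.univ) = theta G :=
  theta_congr (SimpleGraph.induceUnivIso G)

lemma theta_induce_mono [Finite V] (h : S ⊆ T) : theta (G.induce S) ≤ theta (G.induce T) :=
  theta_le_of_embedding (SimpleGraph.induceHomOfLE G h)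

lemma theta_induce_le_ncard [Finite V] : theta (G.induce S) ≤ S.ncard := by
  have h : CliqueColoringOn G (id : V → V) S := fun a _ b _ hab hne => absurd hab hne
  simpa using theta_induce_le_of_coloring h

lemma theta_induce_le_one_of_isClique [Finite V] (h : G.IsClique S) :
    theta (G.induce S) ≤ 1 := by
  have h : CliqueColoringOn G (fun _ : V => ()) S := fun a ha b hb _ hne => h ha hb hne
  refine (theta_induce_le_of_coloring h).trans ?_
  exact Set.ncard_le_one_of_subsingleton _

lemma theta_induce_union_le [Finite V] (G : SimpleGraph V) (S T : Set V) :
    theta (G.induce (S ∪ T)) ≤ theta (G.induce S) + theta (G.induce T) := by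
  classical
  obtain ⟨f, hf, -, hfc⟩ := exists_coloringOn_theta G S
  obtain ⟨g, hg, -, hgc⟩ := exists_coloringOn_theta G T
  let h : V → ℕ ⊕ ℕ := fun x => if x ∈ S then .inl (f x) else .inr (g x)
  have hh : CliqueColoringOn G h (S ∪ T) := by
    intro a ha b hb hab hne
    by_cases haS : a ∈ S <;> by_cases hbS : b ∈ S <;> simp [h, haS, hbS] at hab
    · exact hf haS hbS hab hne
    · exact hg (ha.resolve_left haS) (hb.resolve_left hbS) hab hne
  refine (theta_induce_le_of_coloring hh).trans ?_
  have hsub : h '' (S ∪ T) ⊆ Sum.inl '' (f '' S) ∪ Sum.inr '' (g '' T) := by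
    rintro _ ⟨x, hx, rfl⟩
    by_cases hxS : x ∈ S
    · left; exact ⟨f x, ⟨x, hxS, rfl⟩, by simp [h, hxS]⟩
    · right; exact ⟨g x, ⟨x, hx.resolve_left hxS, rfl⟩, by simp [h, hxS]⟩
  calc _ ≤ (Sum.inl '' (f '' S) ∪ Sum.inr '' (g '' T) : Set (ℕ ⊕ ℕ)).ncard :=
        Set.ncard_le_ncard hsub (Set.toFinite _)
    _ ≤ _ := Set.ncard_union_le _ _
    _ = _ := by
      rw [Set.ncard_image_of_injective _ Sum.inl_injective,
        Set.ncard_image_of_injective _ Sum.inr_injective, hfc, hgc]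

/-- There is no edge of `G` between `S` and `T`. -/
def Anticomplete (G : SimpleGraph V) (S T : Set V) : Prop :=
  ∀ ⦃a⦄, a ∈ S → ∀ ⦃b⦄, b ∈ T → ¬ G.Adj a b

/-- No clique meets both sides, so an optimal cover of the union splits into covers of the two parts
with disjoint sets of colours. -/
lemma theta_induce_union [Finite V] (hd : Disjoint S T) (ha : Anticomplete G S T) :
    theta (G.induce (S ∪ T)) = theta (G.induce S) + theta (G.induce T) := by
  refine le_antisymm (theta_induce_union_le G S T) ?_
  obtain ⟨f, hf, -, hfc⟩ := exists_coloringOn_theta G (S ∪ T)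
  rw [← hfc, Set.image_union, Set.ncard_union_eq _ (Set.toFinite _) (Set.toFinite _)]
  · exact add_le_add (theta_induce_le_of_coloring (hf.mono Set.subset_union_left))
      (theta_induce_le_of_coloring (hf.mono Set.subset_union_right))
  · rw [Set.disjoint_left]
    rintro _ ⟨a, haS, rfl⟩ ⟨b, hbT, hab⟩
    have hne : a ≠ b := fun h => Set.disjoint_left.1 hd haS (h ▸ hbT)
    exact ha haS hbT (hf (.inl haS) (.inr hbT) hab.symm hne)

lemma ncard_le_indepNum [Finite V] (h : G.IsIndepSet S) : S.ncard ≤ G.indepNum := by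
  classical
  rw [Set.ncard_eq_toFinset_card S S.toFinite]
  exact SimpleGraph.IsIndepSet.card_le_indepNum (by simpa using h)

lemma exists_isIndepSet_ncard_eq [Finite V] (G : SimpleGraph V) :
    ∃ S : Set V, G.IsIndepSet S ∧ S.ncard = G.indepNum := by
  obtain ⟨s, hs⟩ := G.exists_isNIndepSet_indepNum
  exact ⟨s, hs.1, by rw [Set.ncard_coe_finset, hs.2]⟩

lemma indepNum_le_of_embedding {W : Type*} [Finite V] [Finite W] {H : SimpleGraph W}
    (e : H ↪g G) : H.indepNum ≤ G.indepNum := by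
  obtain ⟨S, hS, hc⟩ := exists_isIndepSet_ncard_eq H
  rw [← hc, ← Set.ncard_image_of_injective S e.injective]
  refine ncard_le_indepNum ?_
  rintro _ ⟨a, ha, rfl⟩ _ ⟨b, hb, rfl⟩ hab
  rw [e.map_adj_iff]
  exact hS ha hb (fun h => hab (h ▸ rfl))

lemma indepNum_congr {W : Type*} [Finite V] [Finite W] {H : SimpleGraph W} (e : H ≃g G) :
    H.indepNum = G.indepNum :=
  le_antisymm (indepNum_le_of_embedding e.toEmbedding)
    (indepNum_le_of_embedding e.symm.toEmbedding)

lemma indepNum_induce_univ [Finite V] : (G.induce Set.univ).indepNum = G.indepNum :=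
  indepNum_congr (SimpleGraph.induceUnivIso G)

lemma indepNum_induce_mono [Finite V] (h : S ⊆ T) :
    (G.induce S).indepNum ≤ (G.induce T).indepNum :=
  indepNum_le_of_embedding (SimpleGraph.induceHomOfLE G h)

lemma ncard_le_indepNum_induce [Finite V] (h : G.IsIndepSet S) (hST : S ⊆ T) :
    S.ncard ≤ (G.induce T).indepNum := by
  have h1 : (Subtype.val '' (Subtype.val ⁻¹' S : Set T)) = S := by
    rw [Subtype.image_preimage_coe, Set.inter_eq_right.2 hST]
  rw [← h1, Set.ncard_image_of_injective _ Subtype.val_injective]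
  refine ncard_le_indepNum ?_
  intro a ha b hb hab
  exact h ha hb (fun h => hab (Subtype.ext h))

lemma exists_isIndepSet_subset [Finite V] (G : SimpleGraph V) (T : Set V) :
    ∃ S ⊆ T, G.IsIndepSet S ∧ S.ncard = (G.induce T).indepNum := by
  obtain ⟨S, hS, hc⟩ := exists_isIndepSet_ncard_eq (G.induce T)
  refine ⟨Subtype.val '' S, by simp, ?_, ?_⟩
  · rintro _ ⟨a, ha, rfl⟩ _ ⟨b, hb, rfl⟩ hab
    exact hS ha hb (fun h => hab (h ▸ rfl))
  · rw [Set.ncard_image_of_injective _ Subtype.val_injective, hc]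

lemma indepNum_induce_union [Finite V] (hd : Disjoint S T) (ha : Anticomplete G S T) :
    (G.induce (S ∪ T)).indepNum = (G.induce S).indepNum + (G.induce T).indepNum := by
  refine le_antisymm ?_ ?_
  · obtain ⟨A, hA, hAi, hAc⟩ := exists_isIndepSet_subset G (S ∪ T)
    have : A = A ∩ S ∪ A ∩ T := by rw [← Set.inter_union_distrib_left, Set.inter_eq_left.2 hA]
    rw [← hAc, this]
    refine (Set.ncard_union_le _ _).trans (add_le_add ?_ ?_)
    · exact ncard_le_indepNum_induce (hAi.mono Set.inter_subset_left) Set.inter_subset_right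
    · exact ncard_le_indepNum_induce (hAi.mono Set.inter_subset_left) Set.inter_subset_right
  · obtain ⟨A, hA, hAi, hAc⟩ := exists_isIndepSet_subset G S
    obtain ⟨B, hB, hBi, hBc⟩ := exists_isIndepSet_subset G T
    rw [← hAc, ← hBc, ← Set.ncard_union_eq (hd.mono hA hB)]
    refine ncard_le_indepNum_induce ?_ (Set.union_subset_union hA hB)
    rintro a (h1 | h1) b (h2 | h2) hab
    · exact hAi h1 h2 hab
    · exact ha (hA h1) (hB h2)
    · exact fun h => ha (hA h2) (hB h1) h.symm
    · exact hBi h1 h2 hab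

lemma one_le_indepNum_induce [Finite V] (h : S.Nonempty) : 1 ≤ (G.induce S).indepNum := by
  obtain ⟨x, hx⟩ := h
  simpa using ncard_le_indepNum_induce (G := G) (S := {x}) (by simp [SimpleGraph.IsIndepSet])
    (Set.singleton_subset_iff.2 hx)

lemma isClique_of_indepNum_induce_le_one [Finite V] (h : (G.induce S).indepNum ≤ 1) :
    G.IsClique S := by
  intro a ha b hb hab
  by_contra hn
  have : G.IsIndepSet {a, b} := by
    intro x hx y hy hxy
    simp only [Set.mem_insert_iff, Set.mem_singleton_iff] at hx hy
    rcases hx with rfl | rfl <;> rcases hy with rfl | rfl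
    · exact absurd rfl hxy
    · exact hn
    · exact fun h => hn h.symm
    · exact absurd rfl hxy
  have h2 := ncard_le_indepNum_induce (T := S) this (by
    rintro x (rfl | rfl) <;> assumption)
  rw [Set.ncard_pair hab] at h2
  omega

lemma exists_anticomplete_of_not_connected (hne : S.Nonempty) (h : ¬ (G.induce S).Connected) :
    ∃ A B : Set V, A.Nonempty ∧ B.Nonempty ∧ Disjoint A B ∧ A ∪ B = S ∧ Anticomplete G A B := by
  have : ¬ (G.induce S).Preconnected := fun h' =>
    h ((SimpleGraph.connected_iff _).2 ⟨h', hne.to_subtype⟩)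
  simp only [SimpleGraph.Preconnected, not_forall] at this
  obtain ⟨a, b, hab⟩ := this
  refine ⟨Subtype.val '' {x : S | (G.induce S).Reachable a x},
    Subtype.val '' {x : S | ¬ (G.induce S).Reachable a x},
    ⟨a, a, SimpleGraph.Reachable.refl _, rfl⟩, ⟨b, b, hab, rfl⟩, ?_, ?_, ?_⟩
  · rw [Set.disjoint_image_iff Subtype.val_injective, Set.disjoint_left]
    exact fun x h1 h2 => h2 h1
  · rw [← Set.image_union]
    have : {x : S | (G.induce S).Reachable a x} ∪ {x : S | ¬ (G.induce S).Reachable a x}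
        = Set.univ := Set.union_compl_self _
    rw [this, Set.image_univ, Subtype.range_val]
  · rintro _ ⟨x, hx, rfl⟩ _ ⟨y, hy, rfl⟩ hxy
    exact hy (hx.trans (SimpleGraph.Adj.reachable (by simpa using hxy)))

end Basic


/-! ### Gallai's theorem on vertex-critical graphs, by alternating paths. -/

section Gallai

variable {V : Type*} {ι κ : Type*} {G : SimpleGraph V} {f : V → ι} {g : V → κ}

/-- The colour of `x` is used only once. -/
def Exposed (f : V → ι) (x : V) : Prop := ∀ y, f y = f x → y = x

/-- The fibres of `f` are cliques. -/
def CliqueColoring (G : SimpleGraph V) (f : V → ι) : Prop :=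
  ∀ ⦃a b⦄, f a = f b → a ≠ b → G.Adj a b

lemma CliqueColoring.theta_le [Finite V] (hf : CliqueColoring G f) :
    theta G ≤ (Set.range f).ncard := by
  rw [← theta_induce_univ, ← Set.image_univ]
  exact theta_induce_le_of_coloring fun a _ b _ h => hf h

open Classical in
/-- The colouring `f`, where `x` receives the colour of `y`. -/
def recolor (f : V → ι) (x y : V) : V → ι := fun z => if z = x then f y else f z

@[simp] lemma recolor_self (f : V → ι) (x y : V) : recolor f x y x = f y := if_pos rfl

lemma recolor_of_ne (f : V → ι) {x z : V} (y : V) (h : z ≠ x) : recolor f x y z = f z := if_neg h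

lemma CliqueColoring.recolor_of_adj (hf : CliqueColoring G f) {x y : V}
    (h : ∀ z, f z = f y → z ≠ x → G.Adj x z) : CliqueColoring G (recolor f x y) := by
  intro a b hab hne
  by_cases ha : a = x
  · subst ha
    have hb : b ≠ a := hne.symm
    rw [recolor_self, recolor_of_ne f _ hb] at hab
    exact h b hab.symm hb
  · by_cases hb : b = x
    · subst hb
      rw [recolor_self,
        recolor_of_ne f _ ha] at hab
      exact (h a hab ha).symm
    · rw [recolor_of_ne f _ ha, recolor_of_ne f _ hb] at hab
      exact hf hab hne

/-- An exposed vertex that may be moved to another colour class wastes a colour. -/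
lemma CliqueColoring.theta_lt [Finite V] (hf : CliqueColoring G f) {x y : V}
    (hx : Exposed f x) (hxy : y ≠ x) (h : ∀ z, f z = f y → G.Adj x z) :
    theta G < (Set.range f).ncard := by
  refine (hf.recolor_of_adj (x := x) (y := y) fun z hz _ => h z hz).theta_le.trans_lt ?_
  refine Set.ncard_lt_ncard ⟨?_, fun hsub => ?_⟩ (Set.toFinite _)
  · rintro _ ⟨z, rfl⟩
    by_cases hz : z = x
    · subst hz; exact ⟨y, by simp [recolor]⟩
    · exact ⟨z, by simp [recolor, hz]⟩
  · obtain ⟨z, hz⟩ := hsub ⟨x, rfl⟩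
    by_cases hzx : z = x
    · subst hzx
      rw [recolor_self] at hz
      exact hxy (hx _ hz)
    · rw [recolor_of_ne f _ hzx] at hz
      exact hzx (hx _ hz)

/-- A minimum clique colouring with as few singleton classes as possible. -/
structure Optimal (G : SimpleGraph V) (f : V → Fin (theta G)) : Prop where
  coloring : CliqueColoring G f
  min : ∀ f' : V → Fin (theta G), CliqueColoring G f' →
    {x | Exposed f x}.ncard ≤ {x | Exposed f' x}.ncard

lemma exists_optimal [Finite V] (G : SimpleGraph V) : ∃ f, Optimal G f := by
  obtain ⟨f₀, hf₀⟩ := exists_coloring_theta G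
  have hf₀ : CliqueColoring G f₀ := fun a b h => hf₀ trivial trivial h
  obtain ⟨f, hf, hmin⟩ := WellFounded.has_min
    (InvImage.wf (fun f : V → Fin (theta G) => {x | Exposed f x}.ncard) Nat.lt_wfRel.wf)
    {f | CliqueColoring G f} ⟨f₀, hf₀⟩
  exact ⟨f, hf, fun f' hf' => not_lt.1 (hmin f' hf')⟩

lemma ncard_range_fin_le {k : ℕ} (f : V → Fin k) : (Set.range f).ncard ≤ k := by
  simpa using Set.ncard_le_card (Set.range f)

namespace Optimal

variable {f : V → Fin (theta G)}

/-- If `x` were adjacent to the whole class of `y`, it could join that class and save a colour. If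
the class had a third member, moving `y` into the class of `x` would destroy the singleton `{x}` and
create none, against minimality. -/
lemma exists_partner [Finite V] (hf : Optimal G f) {x y : V} (hx : Exposed f x) (hxy : G.Adj x y) :
    ∃ y', y' ≠ y ∧ f y' = f y ∧ (∀ z, f z = f y → z = y ∨ z = y') ∧ ¬ G.Adj x y' := by
  have hlt : ∀ y, y ≠ x → ∃ z, f z = f y ∧ ¬ G.Adj x z := by
    intro y hy
    by_contra! h
    exact absurd (hf.coloring.theta_lt hx hy h) (not_lt.2 (ncard_range_fin_le f))
  obtain ⟨y', hy', hn⟩ := hlt y hxy.ne'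
  have hyy : y' ≠ y := fun h => hn (h ▸ hxy)
  refine ⟨y', hyy, hy', ?_, hn⟩
  by_contra! h
  obtain ⟨t, ht, hty, hty'⟩ := h
  have hxfy : f x ≠ f y := fun h => hxy.ne' (hx y h.symm)
  have hc : CliqueColoring G (recolor f y x) :=
    hf.coloring.recolor_of_adj fun z hz _ => by rw [hx z hz]; exact hxy.symm
  refine absurd (hf.min _ hc) (not_le.2 (Set.ncard_lt_ncard ⟨?_, fun hsub => ?_⟩ (Set.toFinite _)))
  · intro z hz w hw
    have hzy : z ≠ y := by
      rintro rfl
      have := hz x (by simp [recolor, hxy.ne])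
      exact hxy.ne this
    by_cases hwy : w = y
    · subst hwy
      have hzf : f z = f w := by rw [hw]
      rcases eq_or_ne z y' with rfl | h1
      · exact absurd (hz t (by simp [recolor, hty, hzy, ht, hy'])) hty'
      · exact absurd (hz y' (by simp [recolor, hyy, hzy, hzf, hy'])) (Ne.symm h1)
    · exact hz w (by simp [recolor, hwy, hzy, hw])
  · have hx' := hsub hx
    exact hxy.ne' (hx' y (by simp [recolor, hxy.ne]))

open Classical in
-- The classes `{x}`, `{y, y'}` become `{y'}`, `{x, y}`: only the adjacency of `x` and `y` is
-- needed, and the number of singletons is unchanged. This moves the exposed vertex from `x` to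
-- `y'`.
lemma swap (hf : Optimal G f) {x y y' : V} (hx : Exposed f x) (hxy : G.Adj x y)
    (hyy : y' ≠ y) (hy' : f y' = f y) (hpair : ∀ z, f z = f y → z = y ∨ z = y') :
    Optimal G (f ∘ Equiv.swap x y') := by
  have hxfy : f x ≠ f y := fun h => hxy.ne' (hx y h.symm)
  have hyx' : y' ≠ x := fun h => hxfy (h ▸ hy')
  have hc : CliqueColoring G (f ∘ Equiv.swap x y') := by
    have hsw : ∀ a b, a ≠ b → f (Equiv.swap x y' a) = f (Equiv.swap x y' b) →
        a ≠ x → b ≠ x → G.Adj a b := by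
      intro a b hne hab ha hb
      by_cases ha' : a = y'
      · subst ha'
        rw [Equiv.swap_apply_right] at hab
        have := hx _ hab.symm
        rw [Equiv.swap_apply_eq_iff, Equiv.swap_apply_left] at this
        exact absurd this.symm hne
      · by_cases hb' : b = y'
        · subst hb'
          rw [Equiv.swap_apply_right] at hab
          have := hx _ hab
          rw [Equiv.swap_apply_eq_iff, Equiv.swap_apply_left] at this
          exact absurd this hne
        · rw [Equiv.swap_apply_of_ne_of_ne ha ha', Equiv.swap_apply_of_ne_of_ne hb hb'] at hab
          exact hf.coloring hab hne
    have hsx : ∀ b, b ≠ x → f (Equiv.swap x y' b) = f y → b = y := by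
      intro b hb hfb
      by_cases hb' : b = y'
      · subst hb'
        rw [Equiv.swap_apply_right] at hfb
        exact absurd hfb hxfy
      · rw [Equiv.swap_apply_of_ne_of_ne hb hb'] at hfb
        exact (hpair b hfb).resolve_right hb'
    intro a b hab hne
    simp only [Function.comp_apply] at hab
    by_cases ha : a = x
    · subst ha
      rw [Equiv.swap_apply_left, hy'] at hab
      rw [hsx b hne.symm hab.symm]; exact hxy
    · by_cases hb : b = x
      · subst hb
        rw [Equiv.swap_apply_left, hy'] at hab
        rw [hsx a ha hab]; exact hxy.symm
      · exact hsw a b hne hab ha hb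
  refine ⟨hc, fun f' hf' => ?_⟩
  have : {z | Exposed (f ∘ Equiv.swap x y') z} = Equiv.swap x y' '' {z | Exposed f z} := by
    ext z
    simp only [Set.mem_ofPred_eq, Set.mem_image]
    constructor
    · intro hz
      refine ⟨Equiv.swap x y' z, fun w hw => ?_, by simp⟩
      have := hz (Equiv.swap x y' w) (by simpa using hw)
      rw [← this]; simp
    · rintro ⟨w, hw, rfl⟩ t ht
      have := hw (Equiv.swap x y' t) (by simpa using ht)
      rw [← this]; simp
  rw [this, Set.ncard_image_of_injective _ (Equiv.injective _)]
  exact hf.min f' hf'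

end Optimal

/-- `x` is joined to `v` by a path of length `2 n` of vertices, whose steps are alternately
in a fibre of `g` and in a fibre of `f`. -/
def AltReach (f : V → ι) (g : V → κ) (v : V) : ℕ → V → Prop
  | 0, x => x = v
  | n + 1, x => ∃ y y', g y = g x ∧ y ≠ x ∧ f y' = f y ∧ y' ≠ y ∧ AltReach f g v n y'

/-- The hypothesis says that `X` is a union of fibres of `c`, so no colour occurs on both sides. -/
lemma ncard_image_add_ncard_image_compl [Finite V] {X : Set V} {c : V → ι}
    (hc : ∀ a b, c a = c b → a ∈ X → b ∈ X) :
    (c '' X).ncard + (c '' Xᶜ).ncard = (Set.range c).ncard := by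
  rw [← Set.ncard_union_eq _ (Set.toFinite _) (Set.toFinite _), ← Set.image_union,
    Set.union_compl_self, Set.image_univ]
  rw [Set.disjoint_left]
  rintro _ ⟨a, ha, rfl⟩ ⟨b, hb, hab⟩
  exact hb (hc a b hab.symm ha)

open Classical in
/-- The colouring `c` on `X` and `d` outside of `X`. -/
def glue (X : Set V) (c : V → ι) (d : V → κ) (x : V) : ι ⊕ κ :=
  if x ∈ X then Sum.inl (c x) else Sum.inr (d x)

lemma ncard_range_glue_le [Finite V] (X : Set V) (c : V → ι) (d : V → κ) :
    (Set.range (glue X c d)).ncard ≤ (c '' X).ncard + (d '' Xᶜ).ncard := by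
  rw [← Set.ncard_image_of_injective (c '' X) (Sum.inl_injective (β := κ)),
    ← Set.ncard_image_of_injective (d '' Xᶜ) (Sum.inr_injective (α := ι))]
  refine (Set.ncard_le_ncard ?_ (Set.toFinite _)).trans (Set.ncard_union_le _ _)
  rintro _ ⟨x, rfl⟩
  by_cases hx : x ∈ X
  · left; simpa [glue, hx] using ⟨x, hx, rfl⟩
  · right; simpa [glue, hx] using ⟨x, hx, rfl⟩

lemma CliqueColoring.glue {c : V → ι} {d : V → κ} (hc : CliqueColoring G c)
    (hd : CliqueColoring G d) (X : Set V) : CliqueColoring G (glue X c d) := by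
  intro a b hab hne
  by_cases ha : a ∈ X <;> by_cases hb : b ∈ X <;> simp [ComplementaryBounding.glue, ha, hb] at hab
  · exact hc hab hne
  · exact hd hab hne

/-- Otherwise the set `X` reached from `v` is a union of fibres of both covers, so `f` and `g` can
be exchanged on `X`. The two hybrids use at most `2 θ` colours together, yet in one of them the
adjacent vertices `u` and `v` are both singletons and can be merged. -/
lemma altReach_of_exposed [Finite V] (hf : CliqueColoring G f) (hg : CliqueColoring G g)
    (hfc : (Set.range f).ncard ≤ theta G) (hgc : (Set.range g).ncard ≤ theta G) {u v : V}
    (hu : Exposed f u) (hv : Exposed g v) (huv : G.Adj u v) : ∃ n, AltReach f g v n u := by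
  classical
  by_contra hcon
  let X : Set V := {z | ∃ z', f z' = f z ∧ ∃ n, AltReach f g v n z'}
  have hfX : ∀ a b, f a = f b → a ∈ X → b ∈ X := fun a b hab ⟨z, hz, h⟩ => ⟨z, hz.trans hab, h⟩
  have hgX : ∀ a b, g a = g b → a ∈ X → b ∈ X := by
    rintro z t hzt ⟨z', hz', n, hn⟩
    by_cases htz : t = z
    · exact htz ▸ ⟨z', hz', n, hn⟩
    by_cases hzz : z' = z
    · subst hzz
      -- When `z` itself is reached, its path starts with a `g`-step to some `y`. Another vertex `t`
      -- of that fibre is either `y`, whose `f`-mate is reached by the tail, or can replace `z` at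
      -- the start.
      cases n with
      | zero =>
        have : z' = v := hn
        subst this
        exact absurd (hv t hzt.symm) htz
      | succ n =>
        obtain ⟨y, y', h1, h2, h3, h4, h5⟩ := hn
        by_cases hty : t = y
        · subst hty; exact ⟨y', h3, n, h5⟩
        · exact ⟨t, rfl, n + 1, y, y', h1.trans hzt, fun h => hty h.symm, h3, h4, h5⟩
    · exact ⟨t, rfl, n + 1, z, z', hzt, fun h => htz h.symm, hz', hzz, hn⟩
  have huX : u ∉ X := by
    rintro ⟨z, hz, h⟩
    rw [hu z hz] at h
    exact hcon h
  have hvX : v ∈ X := ⟨v, rfl, 0, rfl⟩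
  have h₁ := ncard_image_add_ncard_image_compl hfX
  have h₂ := ncard_image_add_ncard_image_compl hgX
  have h₃ := (hf.glue hg X).theta_le.trans (ncard_range_glue_le X f g)
  have h₄ := ((hg.glue hf X).theta_lt (x := u) (y := v) ?_ huv.ne' ?_).trans_le
    (ncard_range_glue_le X g f)
  -- `h₃` and `h₄` add up to more than `2 θ`, while `h₁` and `h₂` bound the same sum by `2 θ`.
  · omega
  · intro y hy
    by_cases hyX : y ∈ X <;> simp [glue, hyX, huX] at hy
    exact hu y hy
  · intro z hz
    by_cases hzX : z ∈ X <;> simp [glue, hzX, hvX] at hz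
    rw [hv z hz]; exact huv

open Classical in
-- Each `swap` carries the exposed vertex two steps along the path towards `v`, while `w` stays
-- exposed.
lemma Optimal.exists_exposed_of_altReach [Finite V] {v w : V} (hg : CliqueColoring G g)
    (hv : Exposed g v) : ∀ (n : ℕ) (f : V → Fin (theta G)) (x : V), Optimal G f → Exposed f x →
      Exposed f w → x ≠ w → AltReach f g v n x →
      ∃ f', Optimal G f' ∧ Exposed f' v ∧ Exposed f' w := by
  intro n
  induction n using Nat.strong_induction_on with
  | _ n ih =>
    intro f x hf hx hw hxw hn
    -- The path may be taken shortest for `x` and `f`; this keeps the rest of it away from the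
    -- vertices that the swap recolours.
    by_cases hmin : ∃ m < n, AltReach f g v m x
    · obtain ⟨m, hm, h⟩ := hmin
      exact ih m hm f x hf hx hw hxw h
    push Not at hmin
    cases n with
    | zero =>
      have : x = v := hn
      exact ⟨f, hf, this ▸ hx, hw⟩
    | succ n =>
      obtain ⟨y, y', h1, h2, h3, h4, h5⟩ := hn
      have hxy : G.Adj x y := hg h1.symm h2.symm
      have hpair : ∀ z, f z = f y → z = y ∨ z = y' := by
        obtain ⟨p, hp1, hp2, hp3, -⟩ := hf.exists_partner hx hxy
        have : y' = p := (hp3 y' h3).resolve_left h4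
        rwa [this]
      have hyx : y' ≠ x := fun h => h2 (hx y (by rw [← h3, h]))
      have hyw : y' ≠ w := fun h => h4 ((h ▸ hw y (by rw [← h, h3])).symm)
      have hopt := hf.swap hx hxy h4 h3 hpair
      refine ih n (Nat.lt_succ_self n) (f ∘ Equiv.swap x y') y' hopt ?_ ?_ hyw ?_
      · intro z hz
        simp only [Function.comp_apply, Equiv.swap_apply_right] at hz
        have := hx _ hz
        rwa [Equiv.swap_apply_eq_iff, Equiv.swap_apply_left] at this
      · intro z hz
        simp only [Function.comp_apply] at hz
        rw [Equiv.swap_apply_of_ne_of_ne hxw.symm hyw.symm] at hz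
        have := hw _ hz
        rwa [Equiv.swap_apply_eq_iff, Equiv.swap_apply_of_ne_of_ne hxw.symm hyw.symm] at this
      -- The swap changes `f` only at `x` and `y'`. An `f`-step cannot use the exposed vertex `x`,
      -- and one using `y'` would yield a shorter path from `x` or contradict that `g` exposes `v`.
      · have key : ∀ m ≤ n, ∀ z, AltReach f g v m z →
            AltReach (f ∘ Equiv.swap x y') g v m z := by
          intro m
          induction m with
          | zero => exact fun _ z hz => hz
          | succ m ihm =>
            rintro hm z ⟨t, t', k1, k2, k3, k4, k5⟩
            have htx : t ≠ x := fun h => k4 ((hx t' (h ▸ k3)).trans h.symm)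
            have htx' : t' ≠ x := fun h => k4 (h.trans (hx t (h ▸ k3.symm)).symm)
            have hty' : t' ≠ y' := by
              rintro rfl
              exact hmin (m + 1) (by omega) ⟨y, t', h1, h2, h3, h4, k5⟩
            have hty : t ≠ y' := by
              rintro rfl
              have : t' = y := (hpair t' (k3.trans h3)).resolve_right k4
              subst this
              cases m with
              | zero =>
                have : t' = v := k5
                subst this
                exact h2 (hv x h1.symm).symm
              | succ m =>
                obtain ⟨s, s', j1, j2, j3, j4, j5⟩ := k5
                have hsx : s ≠ x := fun h => j4 ((hx s' (h ▸ j3)).trans h.symm)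
                exact hmin (m + 1) (by omega) ⟨s, s', j1.trans h1, hsx, j3, j4, j5⟩
            refine ⟨t, t', k1, k2, ?_, k4, ihm (by omega) _ k5⟩
            simp only [Function.comp_apply]
            rw [Equiv.swap_apply_of_ne_of_ne htx hty, Equiv.swap_apply_of_ne_of_ne htx' hty', k3]
        exact key n le_rfl y' h5

/-- **Gallai's theorem** on critical graphs with connected complements, in terms of clique
covers. -/
theorem two_mul_theta_le_card_add_one [Finite V] (hc : G.Preconnected)
    (hcrit : ∀ v, ∃ g : V → ℕ, CliqueColoring G g ∧ (Set.range g).ncard ≤ theta G ∧ Exposed g v) :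
    2 * theta G ≤ Nat.card V + 1 := by
  classical
  have := Fintype.ofFinite V
  obtain ⟨f, hf⟩ := exists_optimal G
  have hsing : {x | Exposed f x}.ncard ≤ 1 := by
    rw [Set.ncard_le_one_iff]
    intro u w hu hw
    by_contra huw
    -- `R` is closed under adjacency, so by connectedness it would contain `w`, which its definition
    -- forbids.
    let R : Set V := {x | x ≠ w ∧ ∃ f, Optimal G f ∧ Exposed f x ∧ Exposed f w}
    have hR : ∀ x y, G.Adj x y → x ∈ R → y ∈ R := by
      rintro x v hxv ⟨hxw, f, hf, hx, hw⟩
      refine ⟨?_, ?_⟩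
      · rintro rfl
        obtain ⟨y', h1, h2, -⟩ := hf.exists_partner hx hxv
        exact h1 (hw y' h2)
      · obtain ⟨g, hg, hgc, hv⟩ := hcrit v
        obtain ⟨n, hn⟩ := altReach_of_exposed hf.coloring hg (ncard_range_fin_le f) hgc hx hv hxv
        exact Optimal.exists_exposed_of_altReach hg hv n f x hf hx hw hxw hn
    have hreach : ∀ x y, G.Reachable x y → x ∈ R → y ∈ R := by
      rintro x y ⟨p⟩
      induction p with
      | nil => exact id
      | cons h _ ih => exact fun hx => ih (hR _ _ h hx)
    exact (hreach u w (hc u w) ⟨huw, f, hf, hu, hw⟩).1 rfl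
  have hfib : ∀ c : Fin (theta G), ∃ x, f x = c := by
    intro c
    by_contra! h
    have h1 := hf.coloring.theta_le
    have h2 : (Set.range f).ncard < (Set.univ : Set (Fin (theta G))).ncard := by
      refine Set.ncard_lt_ncard ⟨Set.subset_univ _, fun hs => ?_⟩ (Set.toFinite _)
      obtain ⟨x, hx⟩ := hs (Set.mem_univ c)
      exact h x hx
    rw [Set.ncard_univ, Nat.card_fin] at h2
    omega
  choose r hr using hfib
  let T : Finset (Fin (theta G)) := Finset.univ.filter fun c => Exposed f (r c)
  have hT : T.card ≤ 1 := by
    refine le_trans ?_ hsing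
    rw [← Set.ncard_coe_finset, ← Set.ncard_image_of_injective (T : Set (Fin (theta G)))
      (f := r) (fun a b hab => by rw [← hr a, hab, hr b])]
    refine Set.ncard_le_ncard ?_ (Set.toFinite _)
    rintro _ ⟨c, hc, rfl⟩
    exact (Finset.mem_filter.1 (Finset.mem_coe.1 hc)).2
  have hcard : Fintype.card V = ∑ c, (Finset.univ.filter fun x => f x = c).card :=
    Finset.card_eq_sum_card_fiberwise (fun _ _ => Finset.mem_coe.2 (Finset.mem_univ _))
  -- Summed over all colours, this gives `2 θ ≤ |V| + |T|`, with `T` the set of singleton colours.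
  have hge : ∀ c, 2 ≤ (Finset.univ.filter fun x => f x = c).card + if c ∈ T then 1 else 0 := by
    intro c
    have h1 : r c ∈ Finset.univ.filter fun x => f x = c := by simp [hr]
    by_cases hcT : c ∈ T
    · have := Finset.card_pos.2 ⟨_, h1⟩
      simp only [hcT, if_true]
      omega
    · have : ¬ Exposed f (r c) := by simpa [T] using hcT
      simp only [Exposed, not_forall] at this
      obtain ⟨y, hy, hne⟩ := this
      have : 1 < (Finset.univ.filter fun x => f x = c).card :=
        Finset.one_lt_card.2 ⟨_, h1, y, by simp [hy, hr], Ne.symm hne⟩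
      simp only [hcT, if_false]
      omega
  have hsum := Finset.sum_le_sum fun c (_ : c ∈ (Finset.univ : Finset (Fin (theta G)))) => hge c
  rw [Finset.sum_add_distrib, ← hcard] at hsum
  simp at hsum
  rw [Nat.card_eq_fintype_card]
  omega

/-- Gallai's theorem for an induced subgraph. -/
theorem two_mul_theta_induce_le [Finite V] {S : Set V} (hc : (G.induce S).Connected)
    (hcrit : ∀ v ∈ S, theta (G.induce (S \ {v})) < theta (G.induce S)) :
    2 * theta (G.induce S) ≤ S.ncard + 1 := by
  classical
  rw [← Nat.card_coe_set_eq]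
  refine two_mul_theta_le_card_add_one hc.preconnected fun v => ?_
  obtain ⟨g, hg, hlt, hgc⟩ := exists_coloringOn_theta G (S \ {(v : V)})
  have hcr := hcrit v v.2
  set t := theta (G.induce (S \ {(v : V)})) with ht
  have hval : ∀ x : S, x ≠ v → g x < t := fun x hx =>
    hlt x ⟨x.2, fun h => hx (Subtype.ext h)⟩
  -- The cover of `S \ {v}` uses colours below `t`; giving `v` the colour `t` makes it exposed, and
  -- `t + 1 ≤ theta (G.induce S)` by criticality.
  refine ⟨fun x => if x = v then t else g x, ?_, ?_, ?_⟩
  · intro a b hab hne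
    by_cases ha : a = v
    · have hb : b ≠ v := fun h => hne (ha.trans h.symm)
      have := hval b hb
      simp [ha, hb] at hab; omega
    · by_cases hb : b = v
      · have := hval a ha
        simp [ha, hb] at hab; omega
      · simp [ha, hb] at hab
        exact hg ⟨a.2, fun h => ha (Subtype.ext h)⟩ ⟨b.2, fun h => hb (Subtype.ext h)⟩ hab
          (fun h => hne (Subtype.ext h))
  · refine le_trans (Set.ncard_le_ncard (t := Set.Iio (t + 1)) ?_ (Set.finite_Iio _)) ?_
    · rintro _ ⟨x, rfl⟩
      by_cases hx : x = v
      · simp [hx]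
      · have := hval x hx
        simp [hx]; omega
    · rw [← Nat.card_coe_set_eq]; simpa using hcr
  · intro y hy
    by_contra hyv
    have := hval y hyv
    simp [hyv] at hy; omega

end Gallai


/-! ### The inequality `5 θ ≤ 8 α` in the class `𝒞`. -/

section Bound

variable {V : Type*} {G : SimpleGraph V} {S : Set V}

lemma four_le_indepNum_induce [Finite V] {x t y z : V} (hx : x ∈ S) (ht : t ∈ S) (hy : y ∈ S)
    (hz : z ∈ S) (hxt : x ≠ t) (hxy : x ≠ y) (hxz : x ≠ z) (hty : t ≠ y) (htz : t ≠ z)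
    (hyz : y ≠ z) (h1 : ¬ G.Adj x t) (h2 : ¬ G.Adj x y) (h3 : ¬ G.Adj x z) (h4 : ¬ G.Adj t y)
    (h5 : ¬ G.Adj t z) (h6 : ¬ G.Adj y z) : 4 ≤ (G.induce S).indepNum := by
  have hI : G.IsIndepSet {x, t, y, z} := by
    have hsymm : ∀ {a b}, ¬ G.Adj a b → ¬ G.Adj b a := fun h h' => h h'.symm
    rintro a (rfl | rfl | rfl | rfl) b (rfl | rfl | rfl | rfl) hab <;>
      first | exact absurd rfl hab | assumption | (apply hsymm; assumption)
  have hc : ({x, t, y, z} : Set V).ncard = 4 := by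
    rw [Set.ncard_insert_of_notMem, Set.ncard_insert_of_notMem, Set.ncard_pair hyz] <;> simp [*]
  rw [← hc]
  refine ncard_le_indepNum_induce hI ?_
  rintro a (rfl | rfl | rfl | rfl) <;> assumption

/-- The Ramsey bound `R(3, 4) ≤ 9`. -/
lemma four_le_indepNum_of_cliqueFree_three [Fintype V] (hc : Fintype.card V = 9)
    (h3 : G.CliqueFree 3) : 4 ≤ G.indepNum := by
  classical
  by_contra! hα
  have hind : ∀ s : Finset V, G.IsIndepSet s → s.card ≤ 3 := fun s hs =>
    hs.card_le_indepNum.trans (by omega)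
  have htri : ∀ a b c, G.Adj a b → G.Adj a c → G.Adj b c → False := fun a b c hab hac hbc =>
    h3 {a, b, c} (SimpleGraph.is3Clique_triple_iff.2 ⟨hab, hac, hbc⟩)
  have hdeg : ∀ x, G.degree x = 3 := by
    intro x
    refine le_antisymm ?_ ?_
    · refine hind _ ?_
      rw [SimpleGraph.coe_neighborFinset]
      exact G.isIndepSet_neighborSet_of_triangleFree h3 x
    -- With at most two neighbours, `x` has at least six non-neighbours `M`. As in `R(3,3) ≤ 6`, a
    -- vertex `y` of `M` has at least three non-neighbours in `M`; two nonadjacent ones would extend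
    -- `x, y` to a stable set of size 4, so they contain a triangle.
    by_contra! hlt
    let M : Finset V := Finset.univ \ insert x (G.neighborFinset x)
    have hM : 6 ≤ M.card := by
      have h1 := Finset.card_insert_le x (G.neighborFinset x)
      have h2 := Finset.le_card_sdiff (insert x (G.neighborFinset x)) Finset.univ
      rw [Finset.card_univ, hc] at h2
      rw [SimpleGraph.card_neighborFinset_eq_degree] at h1
      change 6 ≤ (Finset.univ \ insert x (G.neighborFinset x)).card
      omega
    have hMx : ∀ z ∈ M, z ≠ x ∧ ¬ G.Adj x z := by
      intro z hz
      simpa [M] using hz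
    obtain ⟨y, hy⟩ := Finset.card_pos.1 (by omega : 0 < M.card)
    have hN : (M ∩ G.neighborFinset y).card ≤ 2 := by
      have hx : x ∉ M ∩ G.neighborFinset y := fun h =>
        (hMx x (Finset.mem_inter.1 h).1).1 rfl
      have := hind (insert x (M ∩ G.neighborFinset y)) ?_
      · rw [Finset.card_insert_of_notMem hx] at this; omega
      · intro a ha b hb hab hadj
        simp only [Finset.coe_insert, Finset.coe_inter, SimpleGraph.coe_neighborFinset,
          Set.mem_insert_iff, Set.mem_inter_iff, Finset.mem_coe,
          SimpleGraph.mem_neighborSet] at ha hb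
        rcases ha with rfl | ha <;> rcases hb with rfl | hb
        · exact hab rfl
        · exact (hMx b hb.1).2 hadj
        · exact (hMx a ha.1).2 hadj.symm
        · exact htri _ _ _ ha.2 hb.2 hadj
    have hL : 2 < (M \ insert y (M ∩ G.neighborFinset y)).card := by
      have h1 := Finset.card_insert_le y (M ∩ G.neighborFinset y)
      have h2 := Finset.le_card_sdiff (insert y (M ∩ G.neighborFinset y)) M
      omega
    obtain ⟨p, hp, q, hq, r, hr, hpq, hpr, hqr⟩ := Finset.two_lt_card.1 hL
    have hadj : ∀ p ∈ M \ insert y (M ∩ G.neighborFinset y),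
        ∀ q ∈ M \ insert y (M ∩ G.neighborFinset y), p ≠ q → G.Adj p q := by
      intro p hp q hq hpq
      by_contra hn
      simp only [Finset.mem_sdiff, Finset.mem_insert, Finset.mem_inter,
        SimpleGraph.mem_neighborFinset, not_or, not_and] at hp hq
      have hxy := hMx y hy
      have hxp := hMx p hp.1
      have hxq := hMx q hq.1
      have hyp := hp.2.2 hp.1
      have hyq := hq.2.2 hq.1
      have := four_le_indepNum_induce (G := G) (Set.mem_univ x) (Set.mem_univ y) (Set.mem_univ p)
        (Set.mem_univ q) hxy.1.symm hxp.1.symm hxq.1.symm (Ne.symm hp.2.1) (Ne.symm hq.2.1) hpq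
        hxy.2 hxp.2 hxq.2 hyp hyq hn
      rw [indepNum_induce_univ] at this
      omega
    exact htri p q r (hadj p hp q hq hpq) (hadj p hp r hr hpr) (hadj q hq r hr hqr)
  -- The degree sum would be `9 · 3 = 27`, which is odd.
  have hsum := G.sum_degrees_eq_twice_card_edges
  simp [hdeg, hc] at hsum
  omega

lemma theta_induce_le_four_of_cover [Finite V] {K L M : Set V} (h : S ⊆ K ∪ L ∪ M)
    (hK : G.IsClique K) (hL : G.IsClique L) (hM : theta (G.induce M) ≤ 2) :
    theta (G.induce S) ≤ 4 := by
  have h1 := theta_induce_mono (G := G) h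
  have h2 := theta_induce_union_le G (K ∪ L) M
  have h3 := theta_induce_union_le G K L
  have h4 := theta_induce_le_one_of_isClique hK
  have h5 := theta_induce_le_one_of_isClique hL
  omega

/-- A triangle, an isolated vertex `x` and a critical graph `B` with `θ(B) = 3`. -/
lemma theta_induce_le_four [Finite V] {B : Set V} {x a b c : V} (hα : (G.induce S).indepNum ≤ 3)
    (hab : G.Adj a b) (hac : G.Adj a c) (hbc : G.Adj b c) (hxS : x ∈ S) (haS : a ∈ S)
    (hbS : b ∈ S) (hcS : c ∈ S) (hBS : B ⊆ S) (hxa : x ≠ a) (hxb : x ≠ b) (hxc : x ≠ c)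
    (hxB : x ∉ B) (haB : a ∉ B) (hbB : b ∉ B) (hcB : c ∉ B)
    (hS : ∀ s ∈ S, s = x ∨ s = a ∨ s = b ∨ s = c ∨ s ∈ B)
    (hB : theta (G.induce B) = 3) (hcrit : ∀ y ∈ B, theta (G.induce (B \ {y})) ≤ 2)
    (hxB' : ∀ y ∈ B, ¬ G.Adj x y) (hx : G.Adj x a ∨ G.Adj x b ∨ G.Adj x c) :
    theta (G.induce S) ≤ 4 := by
  have hne : ∀ y ∈ B, x ≠ y := fun y hy h => hxB (h ▸ hy)
  -- Two nonadjacent non-neighbours of `t` in `B` would form a stable set of size 4 with `x` and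
  -- `t`. As `θ(B) = 3`, two such cliques cannot cover `B`; hence the common neighbours below.
  have hclique : ∀ t, t ∈ S → t ∉ B → x ≠ t → ¬ G.Adj x t →
      G.IsClique {y ∈ B | ¬ G.Adj t y} := by
    rintro t htS htB hxt hn y ⟨hy, hty⟩ z ⟨hz, htz⟩ hyz
    by_contra hnyz
    have := four_le_indepNum_induce hxS htS (hBS hy) (hBS hz) hxt (hne y hy) (hne z hz)
      (fun h => htB (h ▸ hy)) (fun h => htB (h ▸ hz)) hyz hn (hxB' y hy) (hxB' z hz) hty htz hnyz
    omega
  -- a common neighbour in `B` of two vertices that are not adjacent to `x`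
  have hcommon : ∀ t u, t ∈ S → t ∉ B → x ≠ t → ¬ G.Adj x t → u ∈ S → u ∉ B → x ≠ u →
      ¬ G.Adj x u → ∃ y ∈ B, G.Adj t y ∧ G.Adj u y := by
    intro t u h1 h2 h3 h4 h5 h6 h7 h8
    by_contra! h
    have hsub : B ⊆ {y ∈ B | ¬ G.Adj t y} ∪ {y ∈ B | ¬ G.Adj u y} := by
      intro y hy
      by_cases hty : G.Adj t y
      · exact .inr ⟨hy, h y hy hty⟩
      · exact .inl ⟨hy, hty⟩
    have k1 := theta_induce_mono (G := G) hsub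
    have k2 := theta_induce_union_le G {y ∈ B | ¬ G.Adj t y} {y ∈ B | ¬ G.Adj u y}
    have k3 := theta_induce_le_one_of_isClique (hclique t h1 h2 h3 h4)
    have k4 := theta_induce_le_one_of_isClique (hclique u h5 h6 h7 h8)
    omega
  -- One triangle vertex `t` misses `x`: cover by `{x, u, w}`, `{t, y}` and two cliques for `B \
  -- {y}`, where `y` is a neighbour of `t` in `B`.
  have hone : ∀ t u w, t ∈ S → t ∉ B → x ≠ t → ¬ G.Adj x t → G.Adj x u → G.Adj x w → G.Adj u w →
      (∀ s ∈ S, s = x ∨ s = t ∨ s = u ∨ s = w ∨ s ∈ B) → theta (G.induce S) ≤ 4 := by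
    intro t u w h1 h2 h3 h4 hxu hxw huw hS
    obtain ⟨y, hy, hty, -⟩ := hcommon t t h1 h2 h3 h4 h1 h2 h3 h4
    refine theta_induce_le_four_of_cover (K := {x, u, w}) (L := {t, y}) (M := B \ {y}) ?_ ?_ ?_
      (hcrit y hy)
    · intro s hs
      rcases hS s hs with h | h | h | h | h <;> by_cases hsy : s = y <;> simp [h, hsy]
    · simp [SimpleGraph.isClique_insert, *]
    · simp [SimpleGraph.isClique_insert, *]
  -- Two triangle vertices miss `x`: cover by `{x, w}`, the triangle `{t, u, y}` and two cliques for
  -- `B \ {y}`.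
  have htwo : ∀ t u w, t ∈ S → t ∉ B → x ≠ t → ¬ G.Adj x t → u ∈ S → u ∉ B → x ≠ u →
      ¬ G.Adj x u → G.Adj x w → G.Adj t u →
      (∀ s ∈ S, s = x ∨ s = t ∨ s = u ∨ s = w ∨ s ∈ B) → theta (G.induce S) ≤ 4 := by
    intro t u w h1 h2 h3 h4 h5 h6 h7 h8 hxw htu hS
    obtain ⟨y, hy, hty, huy⟩ := hcommon t u h1 h2 h3 h4 h5 h6 h7 h8
    refine theta_induce_le_four_of_cover (K := {x, w}) (L := {t, u, y}) (M := B \ {y}) ?_ ?_ ?_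
      (hcrit y hy)
    · intro s hs
      rcases hS s hs with h | h | h | h | h <;> by_cases hsy : s = y <;> simp [h, hsy]
    · simp [SimpleGraph.isClique_insert, *]
    · simp [SimpleGraph.isClique_insert, *]
  by_cases h1 : G.Adj x a <;> by_cases h2 : G.Adj x b <;> by_cases h3 : G.Adj x c
  · have hsub : S ⊆ {x, a, b, c} ∪ B := by
      intro s hs
      rcases hS s hs with h | h | h | h | h <;> simp [h]
    have hK : G.IsClique {x, a, b, c} := by
      simp [SimpleGraph.isClique_insert, *]
    have k1 := theta_induce_mono (G := G) hsub
    have k2 := theta_induce_union_le G {x, a, b, c} B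
    have k3 := theta_induce_le_one_of_isClique hK
    omega
  · exact hone c a b hcS hcB hxc h3 h1 h2 hab (by grind)
  · exact hone b a c hbS hbB hxb h2 h1 h3 hac (by grind)
  · exact htwo b c a hbS hbB hxb h2 hcS hcB hxc h3 h1 hbc (by grind)
  · exact hone a b c haS haB hxa h1 h2 h3 hbc (by grind)
  · exact htwo a c b haS haB hxa h1 hcS hcB hxc h3 h2 hac (by grind)
  · exact htwo a b c haS haB hxa h1 hbS hbB hxb h2 h3 hab (by grind)
  · tauto

lemma theta_induce_diff_singleton_ge [Finite V] (G : SimpleGraph V) (S : Set V) (v : V) :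
    theta (G.induce S) ≤ theta (G.induce (S \ {v})) + 1 := by
  have h1 : S ⊆ S \ {v} ∪ {v} := by rw [Set.sdiff_union_self]; exact Set.subset_union_left
  have h2 := theta_induce_mono (G := G) h1
  have h3 := theta_induce_union_le G (S \ {v}) {v}
  have h4 := theta_induce_le_one_of_isClique (G := G) (S := {v}) (by simp)
  omega

/-- Every induced subgraph with large `θ` contains a vertex-critical one. -/
lemma exists_critical_subset [Finite V] {k : ℕ} (h : k + 1 ≤ theta (G.induce S)) :
    ∃ T ⊆ S, theta (G.induce T) = k + 1 ∧ ∀ v ∈ T, theta (G.induce (T \ {v})) ≤ k := by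
  obtain ⟨T, ⟨hTS, hT⟩, hmin⟩ := WellFounded.has_min
    (InvImage.wf (fun T : Set V => T.ncard) Nat.lt_wfRel.wf)
    {T | T ⊆ S ∧ k + 1 ≤ theta (G.induce T)} ⟨S, subset_rfl, h⟩
  have hcrit : ∀ v ∈ T, theta (G.induce (T \ {v})) ≤ k := by
    intro v hv
    by_contra! hlt
    exact hmin (T \ {v}) ⟨Set.sdiff_subset.trans hTS, hlt⟩ (Set.ncard_sdiff_singleton_lt_of_mem hv)
  refine ⟨T, hTS, le_antisymm ?_ hT, hcrit⟩
  have hne : T.Nonempty := by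
    by_contra hne
    rw [Set.not_nonempty_iff_eq_empty] at hne
    have := theta_induce_le_ncard (G := G) (S := T)
    rw [hne, Set.ncard_empty] at this
    rw [hne] at hT
    omega
  obtain ⟨v, hv⟩ := hne
  have := theta_induce_diff_singleton_ge G T v
  have := hcrit v hv
  omega

/-- If `θ ≥ 5`, the six vertices outside a triangle have `θ ≥ 4`. Gallai's theorem and the induction
hypothesis force them to consist of a vertex `x` anticomplete to a critical five-vertex graph `B`
with `θ(B) = 3`, and then four cliques suffice after all. -/
lemma theta_induce_le_four_of_ncard_eq_nine [Finite V] (hn : S.ncard = 9) (hα : (G.induce S).indepNum ≤ 3)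
    (ih : ∀ T ⊂ S, 5 * theta (G.induce T) ≤ 8 * (G.induce T).indepNum) :
    theta (G.induce S) ≤ 4 := by
  classical
  by_contra! hθ
  have htri : ∃ a ∈ S, ∃ b ∈ S, ∃ c ∈ S, G.Adj a b ∧ G.Adj a c ∧ G.Adj b c := by
    by_contra! h
    have := Fintype.ofFinite S
    have h4 := four_le_indepNum_of_cliqueFree_three (G := G.induce S)
      (by rw [← Nat.card_eq_fintype_card, Nat.card_coe_set_eq, hn]) (by
        intro s hs
        obtain ⟨a, b, c, hab, hac, hbc, -⟩ := SimpleGraph.is3Clique_iff.1 hs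
        exact h a a.2 b b.2 c c.2 (by simpa using hab) (by simpa using hac) (by simpa using hbc))
    omega
  obtain ⟨a, haS, b, hbS, c, hcS, hab, hac, hbc⟩ := htri
  have hTc : ({a, b, c} : Set V).ncard = 3 :=
    Set.ncard_eq_three.2 ⟨a, b, c, hab.ne, hac.ne, hbc.ne, rfl⟩
  have hTS : ({a, b, c} : Set V) ⊆ S := by rintro _ (rfl | rfl | rfl) <;> assumption
  set H := S \ {a, b, c} with hH
  have hHc : H.ncard = 6 := by rw [hH, Set.ncard_sdiff hTS, hn, hTc]
  have hHθ : 3 + 1 ≤ theta (G.induce H) := by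
    have h1 := theta_induce_union_le G H {a, b, c}
    have h2 := theta_induce_le_one_of_isClique (G := G) (S := {a, b, c})
      (by simp [SimpleGraph.isClique_insert, *])
    rw [hH, Set.sdiff_union_of_subset hTS, ← hH] at h1
    omega
  obtain ⟨K, hKH, hKθ, hKcrit⟩ := exists_critical_subset hHθ
  have hKS : K ⊆ S := hKH.trans Set.sdiff_subset
  have hKc : K.ncard ≤ 6 := hHc ▸ Set.ncard_le_ncard hKH
  have hKα := (indepNum_induce_mono (G := G) hKS).trans hα
  -- A connected `K` would give `2 · 4 ≤ 6 + 1` by Gallai's theorem.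
  have hdis : ¬ (G.induce K).Connected := by
    intro hc
    have := two_mul_theta_induce_le hc fun v hv => by
      have := hKcrit v hv
      omega
    omega
  have hKne : K.Nonempty := by
    by_contra hne
    rw [Set.not_nonempty_iff_eq_empty] at hne
    have := theta_induce_le_ncard (G := G) (S := K)
    rw [hne, Set.ncard_empty] at this
    rw [hne] at hKθ
    omega
  obtain ⟨A, B, hA, hB, hdisj, hunion, hanti, hAα⟩ : ∃ A B : Set V, A.Nonempty ∧ B.Nonempty ∧
      Disjoint A B ∧ A ∪ B = K ∧ Anticomplete G A B ∧ (G.induce A).indepNum ≤ 1 := by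
    obtain ⟨A, B, hA, hB, hdisj, hunion, hanti⟩ := exists_anticomplete_of_not_connected hKne hdis
    have h := indepNum_induce_union hdisj hanti
    rw [hunion] at h
    by_cases hA1 : (G.induce A).indepNum ≤ 1
    · exact ⟨A, B, hA, hB, hdisj, hunion, hanti, hA1⟩
    · exact ⟨B, A, hB, hA, hdisj.symm, Set.union_comm B A ▸ hunion,
        fun x hx y hy h => hanti hy hx h.symm, by omega⟩
  have hAK : A ⊆ K := hunion ▸ Set.subset_union_left
  have hBK : B ⊆ K := hunion ▸ Set.subset_union_right
  have hαu := indepNum_induce_union hdisj hanti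
  have hθu := theta_induce_union hdisj hanti
  rw [hunion] at hαu hθu
  have hA1 := one_le_indepNum_induce (G := G) hA
  have hAθ := theta_induce_le_one_of_isClique (isClique_of_indepNum_induce_le_one hAα)
  have hKss : K ⊂ S := by
    refine ⟨hKS, fun h => ?_⟩
    have := Set.ncard_le_ncard h
    omega
  -- `α(B) ≤ 2`, so the induction hypothesis gives `θ(B) ≤ 3`; on the other side `θ(A) ≤ 1` and
  -- `θ(K) = 4`.
  have hBθ : theta (G.induce B) = 3 := by
    have := ih B (lt_of_le_of_lt hBK hKss)
    omega
  have hBcrit : ∀ y ∈ B, theta (G.induce (B \ {y})) ≤ 2 := by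
    intro y hy
    have h1 := hKcrit y (hBK hy)
    have h2 := theta_induce_union (hdisj.mono_right (Set.sdiff_subset (t := {y})))
      (fun a ha b hb => hanti ha hb.1)
    have h3 : A ∪ B \ {y} = K \ {y} := by
      rw [← hunion, Set.union_sdiff_distrib, Set.sdiff_singleton_eq_self
        (Set.disjoint_right.1 hdisj hy)]
    rw [h3] at h2
    omega
  -- If `B` is connected this is Gallai's theorem; otherwise `B` would be a union of two cliques,
  -- against `θ(B) = 3`.
  have hBc : 5 ≤ B.ncard := by
    by_cases hc : (G.induce B).Connected
    · have := two_mul_theta_induce_le hc fun v hv => by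
        have := hBcrit v hv
        omega
      omega
    · obtain ⟨C, D, hC, hD, hd, hu, ha⟩ := exists_anticomplete_of_not_connected hB hc
      have h1 := indepNum_induce_union hd ha
      have h2 := theta_induce_union hd ha
      rw [hu] at h1 h2
      have hC1 := one_le_indepNum_induce (G := G) hC
      have hD1 := one_le_indepNum_induce (G := G) hD
      have := theta_induce_le_one_of_isClique (isClique_of_indepNum_induce_le_one
        (G := G) (S := C) (by omega))
      have := theta_induce_le_one_of_isClique (isClique_of_indepNum_induce_le_one
        (G := G) (S := D) (by omega))
      omega
  have hcard := Set.ncard_union_eq hdisj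
  rw [hunion] at hcard
  have hApos := (Set.ncard_pos).2 hA
  obtain ⟨x, rfl⟩ := Set.ncard_eq_one.1 (by omega : A.ncard = 1)
  have hKeq : K = H := Set.eq_of_subset_of_ncard_le hKH (by
    rw [Set.ncard_singleton] at hcard; omega)
  have hxK : x ∈ K := hAK rfl
  have hnot : ∀ z ∈ K, z ≠ a ∧ z ≠ b ∧ z ≠ c := by
    intro z hz
    have := (hKH hz).2
    simp only [Set.mem_insert_iff, Set.mem_singleton_iff, not_or] at this
    exact this
  have hBS : B ⊆ S := hBK.trans hKS
  have hSeq : ∀ s ∈ S, s = x ∨ s = a ∨ s = b ∨ s = c ∨ s ∈ B := by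
    intro s hs
    by_cases hsT : s ∈ ({a, b, c} : Set V)
    · simp only [Set.mem_insert_iff, Set.mem_singleton_iff] at hsT
      tauto
    · have : s ∈ ({x} ∪ B : Set V) := by rw [hunion, hKeq]; exact ⟨hs, hsT⟩
      rcases this with h | h
      · exact .inl h
      · simp [h]
  by_cases hx : G.Adj x a ∨ G.Adj x b ∨ G.Adj x c
  · have := theta_induce_le_four hα hab hac hbc (hKS hxK) haS hbS hcS hBS (hnot x hxK).1
      (hnot x hxK).2.1 (hnot x hxK).2.2 (Set.disjoint_left.1 hdisj rfl)
      (fun h => (hnot a (hBK h)).1 rfl) (fun h => (hnot b (hBK h)).2.1 rfl)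
      (fun h => (hnot c (hBK h)).2.2 rfl) hSeq hBθ hBcrit (fun y hy => hanti rfl hy) hx
    omega
  -- Now `x` is isolated in `S`, so the rest has `α ≤ 2` and hence `θ ≤ 3`.
  · push Not at hx
    have hd : Disjoint {x} (S \ {x}) := Set.disjoint_sdiff_right
    have ha : Anticomplete G {x} (S \ {x}) := by
      rintro _ rfl s ⟨hs, hsx⟩ hadj
      rcases hSeq s hs with rfl | rfl | rfl | rfl | h
      · exact hsx rfl
      · exact hx.1 hadj
      · exact hx.2.1 hadj
      · exact hx.2.2 hadj
      · exact hanti rfl h hadj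
    have h1 := indepNum_induce_union hd ha
    rw [Set.union_sdiff_cancel (Set.singleton_subset_iff.2 (hKS hxK))] at h1
    have h3 := ih (S \ {x}) ⟨Set.sdiff_subset, fun h => (h (hKS hxK)).2 rfl⟩
    have h4 := theta_induce_diff_singleton_ge G S x
    omega

theorem five_mul_theta_induce_le [Finite V]
    (hC : ∀ S : Set V, S.ncard ≤ 3 * (G.induce S).indepNum) (S : Set V) :
    5 * theta (G.induce S) ≤ 8 * (G.induce S).indepNum := by
  induction hk : S.ncard using Nat.strong_induction_on generalizing S with
  | _ k ih =>
    subst hk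
    have ih : ∀ T ⊂ S, 5 * theta (G.induce T) ≤ 8 * (G.induce T).indepNum := fun T hT =>
      ih _ (Set.ncard_lt_ncard hT) T rfl
    rcases S.eq_empty_or_nonempty with hS | hne
    · have := theta_induce_le_ncard (G := G) (S := S)
      have h0 : S.ncard = 0 := by rw [hS, Set.ncard_empty]
      omega
    by_cases hc : (G.induce S).Connected
    swap
    · obtain ⟨A, B, ⟨a, hA⟩, ⟨b, hB⟩, hd, hu, ha⟩ := exists_anticomplete_of_not_connected hne hc
      have h1 := indepNum_induce_union hd ha
      have h2 := theta_induce_union hd ha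
      rw [hu] at h1 h2
      have h3 := ih A ⟨hu ▸ Set.subset_union_left, fun h =>
        Set.disjoint_left.1 hd (h (hu ▸ .inr hB)) hB⟩
      have h4 := ih B ⟨hu ▸ Set.subset_union_right, fun h =>
        Set.disjoint_left.1 hd hA (h (hu ▸ .inl hA))⟩
      omega
    by_cases hcrit : ∀ v ∈ S, theta (G.induce (S \ {v})) < theta (G.induce S)
    swap
    · push Not at hcrit
      obtain ⟨v, hv, hle⟩ := hcrit
      have h1 := ih (S \ {v}) ⟨Set.sdiff_subset, fun h => (h hv).2 rfl⟩
      have h2 := indepNum_induce_mono (G := G) (Set.sdiff_subset (s := S) (t := {v}))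
      omega
    have h1 := two_mul_theta_induce_le hc hcrit
    have h2 := hC S
    have h3 := one_le_indepNum_induce (G := G) hne
    rcases Nat.lt_or_ge 1 (G.induce S).indepNum with h4 | h4
    swap
    · have := theta_induce_le_one_of_isClique (isClique_of_indepNum_induce_le_one h4)
      omega
    -- `2θ ≤ 3α + 1` implies `5θ ≤ 8α` except when `α = 3` and `θ = 5`, which forces nine vertices.
    by_cases h5 : S.ncard = 9 ∧ (G.induce S).indepNum ≤ 3
    · have := theta_induce_le_four_of_ncard_eq_nine h5.1 h5.2 ih
      omega
    · by_cases h6 : 5 ≤ (G.induce S).indepNum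
      · omega
      · interval_cases (G.induce S).indepNum <;> omega

end Bound


/-! ### The class `𝒞`, 3-colourability and `χ`-boundedness by 3. -/

section Classes

variable {V : Type*} {G : SimpleGraph V}

lemma ncard_le_of_classC [Finite V] (h : classC V G) (S : Set V) :
    S.ncard ≤ 3 * (G.induce S).indepNum := by
  have := h S
  rw [Nat.card_coe_set_eq, div_le_iff₀ (by norm_num)] at this
  exact_mod_cast (by linarith : (S.ncard : ℝ) ≤ 3 * (G.induce S).indepNum)

lemma theta_induce_le_floor [Finite V] (h : classC V G) (S : Set V) :
    theta (G.induce S) ≤ ⌊(8 / 5 : ℝ) * (G.induce S).indepNum⌋₊ := by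
  refine Nat.le_floor ?_
  have : (5 * theta (G.induce S) : ℝ) ≤ 8 * (G.induce S).indepNum := by
    exact_mod_cast five_mul_theta_induce_le (ncard_le_of_classC h) S
  linarith

lemma theta_le_floor [Finite V] (h : classC V G) :
    theta G ≤ ⌊(8 / 5 : ℝ) * G.indepNum⌋₊ := by
  have := theta_induce_le_floor h Set.univ
  rwa [theta_induce_univ, indepNum_induce_univ] at this

lemma card_le_of_colorable_three [Finite V] (h : G.Colorable 3) :
    Nat.card V ≤ 3 * G.indepNum := by
  classical
  have := Fintype.ofFinite V
  obtain ⟨c⟩ := h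
  rw [Nat.card_eq_fintype_card]
  have hcard : Fintype.card V = ∑ i, (Finset.univ.filter fun x => c x = i).card :=
    Finset.card_eq_sum_card_fiberwise (fun _ _ => Finset.mem_coe.2 (Finset.mem_univ _))
  have hle : ∀ i, (Finset.univ.filter fun x => c x = i).card ≤ G.indepNum := by
    intro i
    refine SimpleGraph.IsIndepSet.card_le_indepNum ?_
    intro a ha b hb _ hadj
    simp only [Finset.coe_filter, Finset.mem_univ, true_and, Set.mem_ofPred_eq] at ha hb
    exact c.valid hadj (ha.trans hb.symm)
  have := Finset.sum_le_sum fun i (_ : i ∈ (Finset.univ : Finset (Fin 3))) => hle i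
  rw [← hcard] at this
  simpa using this

lemma classC_of_colorable_three [Finite V] (h : G.Colorable 3) : classC V G := by
  intro S
  have : G.induce S |>.Colorable 3 := h.of_hom (SimpleGraph.Embedding.induce S).toHom
  have := card_le_of_colorable_three this
  rw [div_le_iff₀ (by norm_num)]
  have : (Nat.card S : ℝ) ≤ 3 * (G.induce S).indepNum := by exact_mod_cast this
  linarith

lemma colorable_three_of_chiBoundedBy [Finite V] (h : ChiBoundedBy G fun _ => 3) :
    G.Colorable 3 := by
  have := Fintype.ofFinite V
  have h1 := h Set.univ
  have h2 : (G.induce Set.univ).Colorable 3 := by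
    rw [← SimpleGraph.chromaticNumber_le_iff_colorable]
    -- Finiteness is needed because `toNat` sends `⊤` to `0`.
    have hne : (G.induce Set.univ).chromaticNumber ≠ ⊤ := by
      rw [SimpleGraph.chromaticNumber_ne_top_iff_exists]
      exact ⟨_, (SimpleGraph.colorable_of_fintype G).of_hom
        (SimpleGraph.Embedding.induce Set.univ).toHom⟩
    have h3 : (G.induce Set.univ).chromaticNumber.toNat ≤ 3 := by
      exact_mod_cast (show ((G.induce Set.univ).chromaticNumber.toNat : ℝ) ≤ 3 from h1)
    rw [← ENat.natCast_toNat hne]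
    exact_mod_cast h3
  exact h2.of_hom (SimpleGraph.induceUnivIso G).symm.toHom

lemma chiBoundedBy_of_colorable_three (h : G.Colorable 3) : ChiBoundedBy G fun _ => 3 := by
  intro S
  have h1 : (G.induce S).Colorable 3 := h.of_hom (SimpleGraph.Embedding.induce S).toHom
  have h2 := ENat.toNat_le_toNat h1.chromaticNumber_le (by simp)
  simp only [ENat.toNat_natCast] at h2
  show ((G.induce S).chromaticNumber.toNat : ℝ) ≤ 3
  exact_mod_cast h2

end Classes

/-! ### Additivity over disjoint unions and copies. -/

section DisjointUnions

variable {V W : Type*} {G : SimpleGraph V} {H : SimpleGraph W}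

lemma isCompl_range_inl_inr_anticomplete :
    Disjoint (Set.range (Sum.inl : V → V ⊕ W)) (Set.range Sum.inr) ∧
      Anticomplete (G.sum H) (Set.range Sum.inl) (Set.range Sum.inr) := by
  refine ⟨Set.isCompl_range_inl_range_inr.disjoint, ?_⟩
  rintro _ ⟨a, rfl⟩ _ ⟨b, rfl⟩
  exact SimpleGraph.not_adj_sum_inl_inr a b

lemma theta_sum [Finite V] [Finite W] : theta (G.sum H) = theta G + theta H := by
  obtain ⟨h1, h2⟩ := isCompl_range_inl_inr_anticomplete (G := G) (H := H)
  have h := theta_induce_union h1 h2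
  rw [Set.range_inl_union_range_inr, theta_induce_univ] at h
  rw [h, theta_congr (SimpleGraph.Embedding.isoInduceRange SimpleGraph.Embedding.sumInl : G ≃g _),
    theta_congr (SimpleGraph.Embedding.isoInduceRange SimpleGraph.Embedding.sumInr : H ≃g _)]
  rfl

lemma indepNum_sum [Finite V] [Finite W] : (G.sum H).indepNum = G.indepNum + H.indepNum := by
  obtain ⟨h1, h2⟩ := isCompl_range_inl_inr_anticomplete (G := G) (H := H)
  have h := indepNum_induce_union h1 h2
  rw [Set.range_inl_union_range_inr, indepNum_induce_univ] at h
  rw [h, indepNum_congr (SimpleGraph.Embedding.isoInduceRange SimpleGraph.Embedding.sumInl : G ≃g _),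
    indepNum_congr (SimpleGraph.Embedding.isoInduceRange SimpleGraph.Embedding.sumInr : H ≃g _)]
  rfl

/-- Splitting off the first copy. -/
def copiesSuccIso (k : ℕ) (G : SimpleGraph V) : copies (k + 1) G ≃g G.sum (copies k G) where
  toFun p := Fin.cases (motive := fun _ => V ⊕ (Fin k × V)) (.inl p.2) (fun i => .inr (i, p.2)) p.1
  invFun := Sum.elim (fun x => (0, x)) fun p => (p.1.succ, p.2)
  left_inv := by
    rintro ⟨i, x⟩
    cases i using Fin.cases <;> simp
  right_inv := by rintro (x | ⟨i, x⟩) <;> simp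
  map_rel_iff' := by
    rintro ⟨i, x⟩ ⟨j, y⟩
    cases i using Fin.cases <;> cases j using Fin.cases <;>
      simp [copies, SimpleGraph.sum, Fin.succ_ne_zero, (Fin.succ_ne_zero _).symm]

lemma theta_copies [Finite V] (k : ℕ) : theta (copies k G) = k * theta G := by
  induction k with
  | zero =>
    have := theta_induce_le_ncard (G := copies 0 G) (S := Set.univ)
    rw [theta_induce_univ, Set.ncard_univ] at this
    simpa using this
  | succ k ih => rw [theta_congr (copiesSuccIso k G), theta_sum, ih]; ring

lemma indepNum_copies [Finite V] (k : ℕ) : (copies k G).indepNum = k * G.indepNum := by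
  induction k with
  | zero =>
    obtain ⟨S, -, hS⟩ := exists_isIndepSet_ncard_eq (copies 0 G)
    rw [← hS, zero_mul, Set.ncard_eq_zero]
    exact Set.eq_empty_of_isEmpty S
  | succ k ih => rw [indepNum_congr (copiesSuccIso k G), indepNum_sum, ih]; ring

lemma colorable_copies {n : ℕ} (k : ℕ) (h : G.Colorable n) : (copies k G).Colorable n :=
  h.of_hom ⟨Prod.snd, fun h => h.2⟩

end DisjointUnions

/-! ### The extremal graphs and optimality. -/

section SmallGraphs

lemma card_le_two_mul_theta {V : Type*} [Finite V] {G : SimpleGraph V} (h : G.CliqueFree 3) :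
    Nat.card V ≤ 2 * theta G := by
  classical
  have := Fintype.ofFinite V
  obtain ⟨f, hf⟩ := exists_coloring_theta G
  rw [Nat.card_eq_fintype_card]
  have hcard : Fintype.card V = ∑ i, (Finset.univ.filter fun x => f x = i).card :=
    Finset.card_eq_sum_card_fiberwise (fun _ _ => Finset.mem_coe.2 (Finset.mem_univ _))
  have hle : ∀ i, (Finset.univ.filter fun x => f x = i).card ≤ 2 := by
    intro i
    by_contra! hlt
    obtain ⟨a, ha, b, hb, c, hc, hab, hac, hbc⟩ := Finset.two_lt_card.1 hlt
    simp only [Finset.mem_filter, Finset.mem_univ, true_and] at ha hb hc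
    exact h {a, b, c} (SimpleGraph.is3Clique_triple_iff.2
      ⟨hf trivial trivial (ha.trans hb.symm) hab, hf trivial trivial (ha.trans hc.symm) hac,
        hf trivial trivial (hb.trans hc.symm) hbc⟩)
  have := Finset.sum_le_sum fun i (_ : i ∈ (Finset.univ : Finset (Fin (theta G)))) => hle i
  rw [← hcard] at this
  simp at this
  omega

/-- The general upper bound is met by the lower bound `|V| ≤ 2 θ` for triangle-free graphs, so only
`α` and the order need be known. -/
lemma theta_eq_floor {V : Type*} [Finite V] {G : SimpleGraph V} (h3 : G.Colorable 3)
    (h : G.CliqueFree 3) (hcard : 2 * ⌊(8 / 5 : ℝ) * G.indepNum⌋₊ ≤ Nat.card V + 1) :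
    theta G = ⌊(8 / 5 : ℝ) * G.indepNum⌋₊ := by
  have h1 := theta_le_floor (classC_of_colorable_three h3)
  have h2 := card_le_two_mul_theta h
  omega

instance : DecidableRel R35.Adj := fun x y =>
  decidable_of_iff (x ≠ y ∧ ((x - y = 1 ∨ x - y = 5) ∨ (y - x = 1 ∨ y - x = 5))) (by
    simp [R35])

instance : DecidableRel G58.Adj := fun p q =>
  match p, q with
  | .inl x, .inl y => decidable_of_iff (R35.Adj x y ∧ s(x, y) ≠ s(0, 1)) (by
      have : R35.Adj x y ↔ R35.Adj y x := R35.adj_comm x y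
      have h : s(x, y) = s(y, x) := Sym2.eq_swap
      simp only [G58, subdivideTwice, SimpleGraph.fromRel_adj, ne_eq, Sum.inl.injEq, ← this, ← h,
        or_self]
      exact ⟨fun k => ⟨k.1.ne, k⟩, fun k => k.2⟩)
  | .inl x, .inr i => decidable_of_iff ((x = 0 ∧ i = 0) ∨ (x = 1 ∧ i = 1)) (by
      simp [G58, subdivideTwice])
  | .inr i, .inl x => decidable_of_iff ((x = 0 ∧ i = 0) ∨ (x = 1 ∧ i = 1)) (by
      simp [G58, subdivideTwice])
  | .inr i, .inr j => decidable_of_iff (i ≠ j) (by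
      revert i j; simp [G58, subdivideTwice])

lemma G58_colorable : G58.Colorable 3 :=
  ⟨SimpleGraph.Coloring.mk
    -- The vertices `1, …, 12` are coloured periodically modulo 3. The ends `0` and `1` of the
    -- subdivided edge share colour 0, and the inner vertices of the path get 1 and 2.
    (Sum.elim (fun x => if x = 0 then 0 else Fin.ofNat 3 (x - 1).val) fun i => Fin.ofNat 3 (i + 1))
    (by decide)⟩

lemma G58_cliqueFree : G58.CliqueFree 3 := by
  have : ∀ a b, G58.Adj a b → ∀ c, G58.Adj a c → ¬ G58.Adj b c := by decide
  intro s hs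
  obtain ⟨a, b, c, hab, hac, hbc, -⟩ := SimpleGraph.is3Clique_iff.1 hs
  exact this a b hab c hac hbc

set_option synthInstance.maxSize 2000 in
set_option synthInstance.maxHeartbeats 400000 in
set_option maxRecDepth 4000 in
lemma ncard_le_four_of_isIndepSet_R35 {S : Set (ZMod 13)} (h : R35.IsIndepSet S) :
    S.ncard ≤ 4 := by
  have key : ∀ a b : ZMod 13, a ≠ b → ¬ R35.Adj a b → ∀ c, a ≠ c → ¬ R35.Adj a c → b ≠ c →
      ¬ R35.Adj b c → ∀ d, a ≠ d → ¬ R35.Adj a d → b ≠ d → ¬ R35.Adj b d → c ≠ d →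
      ¬ R35.Adj c d → ∀ e, a ≠ e → ¬ R35.Adj a e → b ≠ e → ¬ R35.Adj b e → c ≠ e →
      ¬ R35.Adj c e → d ≠ e → R35.Adj d e := by
    -- Translation invariance lets the first vertex be `0`, which shrinks the exhaustive check.
    have key0 : ∀ b : ZMod 13, 0 ≠ b → ¬ R35.Adj 0 b → ∀ c, 0 ≠ c → ¬ R35.Adj 0 c → b ≠ c →
        ¬ R35.Adj b c → ∀ d, 0 ≠ d → ¬ R35.Adj 0 d → b ≠ d → ¬ R35.Adj b d → c ≠ d →
        ¬ R35.Adj c d → ∀ e, 0 ≠ e → ¬ R35.Adj 0 e → b ≠ e → ¬ R35.Adj b e → c ≠ e →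
        ¬ R35.Adj c e → d ≠ e → R35.Adj d e := by decide
    have hn : ∀ a b : ZMod 13, a ≠ b → 0 ≠ b - a := fun a b h h' => h (sub_eq_zero.1 h'.symm).symm
    have htr : ∀ a b c : ZMod 13, R35.Adj (b - a) (c - a) ↔ R35.Adj b c := by
      intro a b c
      rw [sub_eq_add_neg, sub_eq_add_neg]
      exact SimpleGraph.circulantGraph_adj_translate
    have h0 : ∀ a b : ZMod 13, R35.Adj 0 (b - a) ↔ R35.Adj a b := by
      intro a b
      rw [← sub_self a, htr]
    intro a b h1 h2 c h3 h4 h5 h6 d h7 h8 h9 h10 h11 h12 e h13 h14 h15 h16 h17 h18 h19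
    have := key0 (b - a) (hn _ _ h1) (by rwa [h0]) (c - a) (hn _ _ h3) (by rwa [h0])
      (fun h => h5 (sub_left_injective h)) (by rwa [htr]) (d - a) (hn _ _ h7) (by rwa [h0])
      (fun h => h9 (sub_left_injective h)) (by rwa [htr]) (fun h => h11 (sub_left_injective h))
      (by rwa [htr]) (e - a) (hn _ _ h13) (by rwa [h0])
      (fun h => h15 (sub_left_injective h)) (by rwa [htr]) (fun h => h17 (sub_left_injective h))
      (by rwa [htr]) (fun h => h19 (sub_left_injective h))
    rwa [htr] at this
  by_contra! hlt
  obtain ⟨T, hTS, hT⟩ := Set.exists_subset_card_eq (show 5 ≤ S.ncard from hlt)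
  have e : T ≃ Fin 5 := Finite.equivFinOfCardEq (by rw [Nat.card_coe_set_eq, hT])
  have hne : ∀ i j, i ≠ j → ((e.symm i : T) : ZMod 13) ≠ e.symm j := fun i j hij h =>
    hij (e.symm.injective (Subtype.ext h))
  have hna : ∀ i j, i ≠ j → ¬ R35.Adj ((e.symm i : T) : ZMod 13) (e.symm j) := fun i j hij =>
    h (hTS (e.symm i).2) (hTS (e.symm j).2) (hne i j hij)
  exact hna 3 4 (by decide) (key (e.symm 0) (e.symm 1) (hne _ _ (by decide)) (hna _ _ (by decide))
    (e.symm 2) (hne _ _ (by decide)) (hna _ _ (by decide)) (hne _ _ (by decide))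
    (hna _ _ (by decide)) (e.symm 3) (hne _ _ (by decide)) (hna _ _ (by decide))
    (hne _ _ (by decide)) (hna _ _ (by decide)) (hne _ _ (by decide)) (hna _ _ (by decide))
    (e.symm 4) (hne _ _ (by decide)) (hna _ _ (by decide)) (hne _ _ (by decide))
    (hna _ _ (by decide)) (hne _ _ (by decide)) (hna _ _ (by decide)) (hne _ _ (by decide)))

/-- Deleting `0` or `1` from the `R_{3,5}` part of a stable set leaves a stable set of `R_{3,5}`, so
that part has at most 5 vertices. If a path vertex is used, it is the only one, and its neighbour
among `0` and `1` is absent, so the part has at most 4. -/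
lemma G58_indepNum_le : G58.indepNum ≤ 5 := by
  obtain ⟨S, hS, hc⟩ := exists_isIndepSet_ncard_eq G58
  rw [← hc]
  let A : Set (ZMod 13) := Sum.inl ⁻¹' S
  let B : Set (Fin 2) := Sum.inr ⁻¹' S
  have hadj : ∀ x y : ZMod 13, R35.Adj x y → ¬ (x = 0 ∧ y = 1) → ¬ (x = 1 ∧ y = 0) →
      G58.Adj (.inl x) (.inl y) := by decide
  have hA : ∀ z : ZMod 13, (z = 0 ∨ z = 1) → R35.IsIndepSet (A \ {z}) := by
    intro z hz x hx y hy hxy hxy'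
    refine hS hx.1 hy.1 (by simpa using hxy) (hadj x y hxy' ?_ ?_)
    · rintro ⟨rfl, rfl⟩
      rcases hz with rfl | rfl
      · exact hx.2 rfl
      · exact hy.2 rfl
    · rintro ⟨rfl, rfl⟩
      rcases hz with rfl | rfl
      · exact hy.2 rfl
      · exact hx.2 rfl
  have hSAB : S = Sum.inl '' A ∪ Sum.inr '' B := by
    ext (x | x) <;> simp [A, B]
  have hSc : S.ncard ≤ A.ncard + B.ncard := by
    conv_lhs => rw [hSAB]
    refine (Set.ncard_union_le _ _).trans ?_
    rw [Set.ncard_image_of_injective _ Sum.inl_injective,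
      Set.ncard_image_of_injective _ Sum.inr_injective]
  have hA5 : A.ncard ≤ 5 := by
    have h1 := ncard_le_four_of_isIndepSet_R35 (hA 0 (.inl rfl))
    have h2 := Set.ncard_le_ncard_sdiff_add_ncard A {0}
    rw [Set.ncard_singleton] at h2
    omega
  rcases B.eq_empty_or_nonempty with hB | ⟨i, hi⟩
  · rw [hB, Set.ncard_empty] at hSc
    omega
  · have hB1 : B.ncard ≤ 1 := by
      refine (Set.ncard_le_one_iff (Set.toFinite _)).2 ?_
      intro j k hj hk
      by_contra hjk
      have : ∀ j k : Fin 2, j ≠ k → G58.Adj (.inr j) (.inr k) := by decide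
      exact hS hj hk (by simpa using hjk) (this j k hjk)
    have hend : ∀ i : Fin 2, ∃ z : ZMod 13, (z = 0 ∨ z = 1) ∧ G58.Adj (.inl z) (.inr i) := by
      decide
    obtain ⟨z, hz, hzi⟩ := hend i
    have hzA : z ∉ A := fun h => hS h hi (by simp) hzi
    have h1 := ncard_le_four_of_isIndepSet_R35 (hA z hz)
    rw [Set.sdiff_singleton_eq_self hzA] at h1
    omega

lemma G58_indepNum : G58.indepNum = 5 := by
  have h := card_le_of_colorable_three G58_colorable
  have := G58_indepNum_le
  have hc : Nat.card (ZMod 13 ⊕ Fin 2) = 15 := by simp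
  omega

lemma G58_theta : theta G58 = 8 := by
  have hfl : ⌊(8 / 5 : ℝ) * (5 : ℕ)⌋₊ = 8 := by norm_num
  rw [theta_eq_floor G58_colorable G58_cliqueFree] <;> rw [G58_indepNum, hfl]
  simp

lemma cycleGraph_five_colorable : (SimpleGraph.cycleGraph 5).Colorable 3 :=
  ⟨SimpleGraph.Coloring.mk ![0, 1, 0, 1, 2] (by decide)⟩

lemma cycleGraph_five_cliqueFree : (SimpleGraph.cycleGraph 5).CliqueFree 3 := by
  have : ∀ a b, (SimpleGraph.cycleGraph 5).Adj a b → ∀ c, (SimpleGraph.cycleGraph 5).Adj a c →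
      ¬ (SimpleGraph.cycleGraph 5).Adj b c := by decide
  intro s hs
  obtain ⟨a, b, c, hab, hac, hbc, -⟩ := SimpleGraph.is3Clique_iff.1 hs
  exact this a b hab c hac hbc

lemma cycleGraph_five_indepNum : (SimpleGraph.cycleGraph 5).indepNum = 2 := by
  have h := card_le_of_colorable_three cycleGraph_five_colorable
  rw [Nat.card_fin] at h
  refine le_antisymm ?_ (by omega)
  obtain ⟨s, hs⟩ := (SimpleGraph.cycleGraph 5).exists_isNIndepSet_indepNum
  rw [← hs.2]
  have : ∀ s : Finset (Fin 5), (SimpleGraph.cycleGraph 5).IsIndepSet s → s.card ≤ 2 := by decide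
  exact this s hs.1

lemma cycleGraph_five_theta : theta (SimpleGraph.cycleGraph 5) = 3 := by
  have hfl : ⌊(8 / 5 : ℝ) * (2 : ℕ)⌋₊ = 3 := by
    rw [Nat.floor_eq_iff (by norm_num)]; norm_num
  rw [theta_eq_floor cycleGraph_five_colorable cycleGraph_five_cliqueFree] <;>
    rw [cycleGraph_five_indepNum, hfl]
  simp

lemma bot_unit_indepNum : (⊥ : SimpleGraph Unit).indepNum = 1 := by
  refine le_antisymm ?_ ?_
  · obtain ⟨S, -, hS⟩ := exists_isIndepSet_ncard_eq (⊥ : SimpleGraph Unit)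
    rw [← hS]
    exact Set.ncard_le_one_of_subsingleton S
  · rw [← indepNum_induce_univ]
    exact one_le_indepNum_induce Set.univ_nonempty

lemma bot_unit_colorable : (⊥ : SimpleGraph Unit).Colorable 3 :=
  ⟨SimpleGraph.Coloring.mk (fun _ => 0) (by simp)⟩

lemma bot_unit_theta : theta (⊥ : SimpleGraph Unit) = 1 := by
  have hfl : ⌊(8 / 5 : ℝ) * (1 : ℕ)⌋₊ = 1 := by
    rw [Nat.floor_eq_iff (by norm_num)]; norm_num
  have hfree : (⊥ : SimpleGraph Unit).CliqueFree 3 := by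
    intro s hs
    obtain ⟨a, b, c, hab, -⟩ := SimpleGraph.is3Clique_iff.1 hs
    exact hab
  rw [theta_eq_floor bot_unit_colorable hfree] <;> rw [bot_unit_indepNum, hfl]
  simp

lemma unionGraph_colorable (a b c : ℕ) : (unionGraph a b c).Colorable 3 :=
  SimpleGraph.colorable_sum.2 ⟨SimpleGraph.colorable_sum.2
    ⟨colorable_copies a G58_colorable, colorable_copies b cycleGraph_five_colorable⟩,
    colorable_copies c bot_unit_colorable⟩

lemma unionGraph_indepNum (a b c : ℕ) : (unionGraph a b c).indepNum = 5 * a + 2 * b + c := by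
  rw [unionGraph, indepNum_sum, indepNum_sum, indepNum_copies, indepNum_copies, indepNum_copies,
    G58_indepNum, cycleGraph_five_indepNum, bot_unit_indepNum]
  ring

lemma unionGraph_theta (a b c : ℕ) : theta (unionGraph a b c) = 8 * a + 3 * b + c := by
  rw [unionGraph, theta_sum, theta_sum, theta_copies, theta_copies, theta_copies,
    G58_theta, cycleGraph_five_theta, bot_unit_theta]
  ring

lemma floor_eight_fifths (x : ℕ) :
    ⌊(8 / 5 : ℝ) * x⌋₊ = 8 * (x / 5) + 3 * (x % 5 / 2) + x % 5 % 2 := by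
  have : (8 / 5 : ℝ) * x = ((8 * x : ℕ) : ℝ) / (5 : ℕ) := by push_cast; ring
  rw [this, Nat.floor_div_eq_div]
  omega

lemma unionGraph_indepNum_eq (x : ℕ) :
    (unionGraph (x / 5) (x % 5 / 2) (x % 5 % 2)).indepNum = x := by
  rw [unionGraph_indepNum]; omega

lemma unionGraph_theta_eq (x : ℕ) :
    theta (unionGraph (x / 5) (x % 5 / 2) (x % 5 % 2)) = ⌊(8 / 5 : ℝ) * x⌋₊ := by
  rw [unionGraph_theta, floor_eight_fifths]

/-- A class between the `3`-colourable graphs and `𝒞` has optimal `θ`-bounding function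
`⌊8x/5⌋`. -/
theorem isOptimalThetaBoundingFunction_of_le {C : GraphClass.{u}}
    (h3 : ∀ (V : Type u) [Finite V] (G : SimpleGraph V), G.Colorable 3 → C V G)
    (hC : ∀ (V : Type u) [Finite V] (G : SimpleGraph V), C V G → classC V G) :
    IsOptimalThetaBoundingFunction C fun x : ℕ => (⌊(8 / 5 : ℝ) * x⌋₊ : ℝ) := by
  refine ⟨fun V _ G hG S => Nat.cast_le.2 (theta_induce_le_floor (hC V G hG) S), ?_⟩
  intro g hg x
  -- The extremal graph is lifted to the universe of the class; evaluating `g` on it gives the lower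
  -- bound at `x`.
  let e := SimpleGraph.Iso.comap Equiv.ulift.{u}
    (unionGraph (x / 5) (x % 5 / 2) (x % 5 % 2))
  have := hg _ _ (h3 _ _ ((unionGraph_colorable (x / 5) (x % 5 / 2) (x % 5 % 2)).of_hom e.toHom))
    Set.univ
  rwa [theta_induce_univ, indepNum_induce_univ, theta_congr e, indepNum_congr e,
    unionGraph_theta_eq, unionGraph_indepNum_eq] at this

end SmallGraphs

end ComplementaryBounding

end

theorem theorem2p1 :
    -- every 3-colourable graph belongs to `𝒞`
    (∀ (V : Type u) [Finite V] (G : SimpleGraph V),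
      G.Colorable 3 → ComplementaryBounding.classC V G) ∧
    -- the upper bound for the graphs of `𝒞`
    (∀ (V : Type u) [Finite V] (G : SimpleGraph V), ComplementaryBounding.classC V G →
      ComplementaryBounding.theta G ≤ ⌊(8 / 5 : ℝ) * G.indepNum⌋₊) ∧
    -- sharpness for every value `x` of `α`, with `⌊x / 5⌋` copies of `G_{5,8}` and, according to
    -- the residue of `x` modulo `5`, at most two pentagons and at most one isolated vertex
    (∀ x : ℕ,
      (ComplementaryBounding.unionGraph (x / 5) (x % 5 / 2) (x % 5 % 2)).Colorable 3 ∧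
      ComplementaryBounding.classC _
        (ComplementaryBounding.unionGraph (x / 5) (x % 5 / 2) (x % 5 % 2)) ∧
      (ComplementaryBounding.unionGraph (x / 5) (x % 5 / 2) (x % 5 % 2)).indepNum = x ∧
      ComplementaryBounding.theta
        (ComplementaryBounding.unionGraph (x / 5) (x % 5 / 2) (x % 5 % 2)) =
        ⌊(8 / 5 : ℝ) * x⌋₊) ∧
    -- the optimal `θ`-bounding function of `𝒞` is `⌊8x/5⌋`
    ComplementaryBounding.IsOptimalThetaBoundingFunction
      ComplementaryBounding.classC.{u} (fun x : ℕ => (⌊(8 / 5 : ℝ) * x⌋₊ : ℝ)) ∧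
    -- `3^* = ⌊8x/5⌋`
    ComplementaryBounding.IsOptimalComplementaryBoundingFunction.{u}
      (fun _ => 3) (fun x : ℕ => (⌊(8 / 5 : ℝ) * x⌋₊ : ℝ)) := by
  open ComplementaryBounding in
  exact ⟨fun V _ G => classC_of_colorable_three, fun V _ G => theta_le_floor,
    fun x => ⟨unionGraph_colorable _ _ _, classC_of_colorable_three (unionGraph_colorable _ _ _),
      unionGraph_indepNum_eq x, unionGraph_theta_eq x⟩,
    isOptimalThetaBoundingFunction_of_le (fun V _ G => classC_of_colorable_three)
      fun V _ G h => h,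
    isOptimalThetaBoundingFunction_of_le (fun V _ G => chiBoundedBy_of_colorable_three)
      fun V _ G h => classC_of_colorable_three (colorable_three_of_chiBoundedBy h)⟩
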